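/- \textbf{Setting.} On $L^2(0,\infty)$ let $K_{\max}f=-f''$ with domain $\{f\in L^2(0,\infty): f,f'\in AC_{\rm loc}(0,\infty),\ f''\in L^2(0,\infty)\}$ and let $K_{\min}$ be its restriction to those $f$ with $f(0^+)=f'(0^+)=0$. All roots are principal branches. Let $\mathbb C_+$ be the open upper half-plane. For $w\in\mathbb C$ let $\mathcal D_w=\operatorname{ran}(K_{\min}-\overline w)^{\perp}=\ker(K_{\min}^*-w)$. Put $$\psi(w;x)=e^{i\sqrt w\,x}\ (w\in\mathbb C_+),\qquad \phi^+(x)=2^{1/4}e^{i\sqrt{i}\,x},\qquad \phi^-(x)=2^{1/4}e^{-i\sqrt{-i}\,x}.$$ For $|\alpha|=1$ let $K_{1,\alpha}$ be the restriction of $K_{\max}$ to $\operatorname{dom}K_{\min}+\operatorname{span}\{\alpha\phi^--\phi^+\}$. The Liv\v sic characteristic function is $$B(w)=\frac{w-i}{w+i}\,\frac{\langle\psi(w),\phi^-\rangle}{\langle\psi(w),\phi^+\rangle},\qquad w\in\mathbb C_+,\qquad \langle f,g\rangle=\int_0^\infty f\,\overline g\,dx.$$ Let $\gamma(w)=\frac{w-i}{w+i}$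 and $B=b\circ\gamma$. The Clark measure $\mu^{b\alpha^*}$ on the unit circle $\mathbb T$ is the finite positive measure with $\int_{\mathbb T}\frac{1-|z|^2}{|t-z|^2}\,d\mu^{b\alpha^*}(t)=\operatorname{Re}\frac{\alpha+b(z)}{\alpha-b(z)}$ for $|z|<1$; the Clark measure $\mu^{B\alpha^*}$ of $K_{1,\alpha}$ on $\mathbb R$ is its pullback, $\mu^{B\alpha^*}(\Omega)=\mu^{b\alpha^*}(\gamma(\Omega))$. Let $m$ be Lebesgue measure on $\mathbb R$. \textbf{Theorem.} (1) For every $w\in\mathbb C_+$ the space $\mathcal D_w$ is spanned by $\psi(w)\neq0$; $\mathcal D_{i}$ and $\mathcal D_{-i}$ are spanned by the unit vectors $\phi^+$ and $\phi^-$ respectively. (2) $B$ is analytic and contractive on $\mathbb C_+$, and $$B(w)=\frac{(w-i)\bigl(\sqrt w-(1-i)/\sqrt2\bigr)}{(w+i)\bigl(\sqrt w+(1+i)/\sqrt2\bigr)},\qquad w\in\mathbb C_+.$$ (3) For every $\alpha\in\mathbb C$ with $|\alpha|=1$, $K_{1,\alpha}$ is a self-adjoint extension of $K_{\min}$, its Clark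 measure $\mu^{B\alpha^*}$ exists and is unique, and the density of the absolutely continuous part of $\mu^{B\alpha^*}$ is, for $m$-a.e. $s\in\mathbb R$, $$\frac{d\mu^{B\alpha^*}}{dm}(s)=\frac{2\operatorname{Re}\sqrt{2s}}{\pi\bigl(|s|+1+2\operatorname{Re}(\sqrt s\,e^{-i\pi/4})\bigr)\,\mathscr D(s)},$$ $$\mathscr D(s)=2(1-\operatorname{Re}\alpha)s^2+2|s|+|i\alpha-1|^2-2^{3/2}(1-\operatorname{Re}\alpha)s^{3/2}+2(1-\operatorname{Re}\alpha+\operatorname{Im}\alpha)s-2^{3/2}(1+\operatorname{Im}\alpha)s^{1/2}.$$ In particular the density vanishes for a.e. $s\le0$. -/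

import Mathlib

open MeasureTheory Filter Topology Set

noncomputable section

namespace HalfLine

/-- The Hilbert space `L²(0, ∞)` of complex-valued functions. -/
abbrev L2 : Type := Lp ℂ 2 (volume.restrict (Ioi (0 : ℝ)))

/-- Local absolute continuity on `(0, ∞)`. -/
def ACLoc (f : ℝ → ℂ) : Prop :=
  ∀ a b : ℝ, 0 < a → a ≤ b → AbsolutelyContinuousOnInterval f a b

/-- `f` is a representative of `u` such that `f` and its derivative `f' = g` are locally absolutely
continuous on `(0, ∞)`, and `v = -f''` almost everywhere (in particular `-f''` is in `L²`). -/
structure IsRep (f g : ℝ → ℂ) (u v : L2) : Prop where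
  ae_eq : ∀ᵐ x ∂(volume.restrict (Ioi (0 : ℝ))), u x = f x
  ac : ACLoc f
  hasDeriv : ∀ x : ℝ, 0 < x → HasDerivAt f (g x) x
  ac_deriv : ACLoc g
  ae_hasDeriv : ∀ᵐ x ∂(volume.restrict (Ioi (0 : ℝ))), HasDerivAt g (-(v x)) x

theorem ACLoc.zero : ACLoc (0 : ℝ → ℂ) := fun _ _ _ _ =>
  (contDiffOn_const (c := (0 : ℂ)) (n := 1)).absolutelyContinuousOnInterval

theorem ACLoc.add {f g : ℝ → ℂ} (hf : ACLoc f) (hg : ACLoc g) : ACLoc (f + g) :=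
  fun a b ha hab => AbsolutelyContinuousOnInterval.add (hf a b ha hab) (hg a b ha hab)

theorem ACLoc.smul {f : ℝ → ℂ} (c : ℂ) (hf : ACLoc f) : ACLoc (c • f) :=
  fun a b ha hab => AbsolutelyContinuousOnInterval.const_smul c (hf a b ha hab)

theorem IsRep.zero : IsRep 0 0 0 0 where
  ae_eq := by filter_upwards [Lp.coeFn_zero ℂ 2 (volume.restrict (Ioi (0 : ℝ)))] with x hx using hx
  ac := ACLoc.zero
  hasDeriv := fun x _ => hasDerivAt_const x 0
  ac_deriv := ACLoc.zero
  ae_hasDeriv := by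
    filter_upwards [Lp.coeFn_zero ℂ 2 (volume.restrict (Ioi (0 : ℝ)))] with x hx
    rw [hx, Pi.zero_apply, neg_zero]
    exact hasDerivAt_const x (0 : ℂ)

theorem IsRep.add {f g f' g' : ℝ → ℂ} {u v u' v' : L2} (h : IsRep f g u v)
    (h' : IsRep f' g' u' v') : IsRep (f + f') (g + g') (u + u') (v + v') where
  ae_eq := by
    filter_upwards [Lp.coeFn_add u u', h.ae_eq, h'.ae_eq] with x h1 h2 h3
    rw [h1, Pi.add_apply, Pi.add_apply, h2, h3]
  ac := h.ac.add h'.ac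
  hasDeriv := fun x hx => (h.hasDeriv x hx).add (h'.hasDeriv x hx)
  ac_deriv := h.ac_deriv.add h'.ac_deriv
  ae_hasDeriv := by
    filter_upwards [Lp.coeFn_add v v', h.ae_hasDeriv, h'.ae_hasDeriv] with x h1 h2 h3
    rw [h1, Pi.add_apply, neg_add]
    exact h2.add h3

theorem IsRep.smul {f g : ℝ → ℂ} {u v : L2} (c : ℂ) (h : IsRep f g u v) :
    IsRep (c • f) (c • g) (c • u) (c • v) where
  ae_eq := by
    filter_upwards [Lp.coeFn_smul c u, h.ae_eq] with x h1 h2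
    rw [h1, Pi.smul_apply, Pi.smul_apply, h2]
  ac := h.ac.smul c
  hasDeriv := fun x hx => (h.hasDeriv x hx).const_smul c
  ac_deriv := h.ac_deriv.smul c
  ae_hasDeriv := by
    filter_upwards [Lp.coeFn_smul c v, h.ae_hasDeriv] with x h1 h2
    rw [h1, Pi.smul_apply, ← smul_neg]
    exact h2.const_smul c

/-- The graph of the maximal operator `-d²/dx²` on `L²(0, ∞)`. -/
def maxGraph : Submodule ℂ (L2 × L2) where
  carrier := {p | ∃ f g : ℝ → ℂ, IsRep f g p.1 p.2}
  zero_mem' := ⟨0, 0, IsRep.zero⟩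
  add_mem' := by
    rintro p q ⟨f, g, h⟩ ⟨f', g', h'⟩
    exact ⟨f + f', g + g', h.add h'⟩
  smul_mem' := by
    rintro c p ⟨f, g, h⟩
    exact ⟨c • f, c • g, h.smul c⟩

/-- The graph of the minimal operator: additionally `f(0+) = f'(0+) = 0`. -/
def minGraph : Submodule ℂ (L2 × L2) where
  carrier := {p | ∃ f g : ℝ → ℂ, IsRep f g p.1 p.2 ∧
    Tendsto f (𝓝[>] 0) (𝓝 0) ∧ Tendsto g (𝓝[>] 0) (𝓝 0)}
  zero_mem' := ⟨0, 0, IsRep.zero, tendsto_const_nhds, tendsto_const_nhds⟩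
  add_mem' := by
    rintro p q ⟨f, g, h, hf, hg⟩ ⟨f', g', h', hf', hg'⟩
    exact ⟨f + f', g + g', h.add h', by rw [← add_zero (0 : ℂ)]; exact hf.add hf',
      by rw [← add_zero (0 : ℂ)]; exact hg.add hg'⟩
  smul_mem' := by
    rintro c p ⟨f, g, h, hf, hg⟩
    exact ⟨c • f, c • g, h.smul c, by rw [← smul_zero (A := ℂ) c]; exact hf.const_smul c,
      by rw [← smul_zero (A := ℂ) c]; exact hg.const_smul c⟩

/-- The relation `maxGraph` is single-valued, so that it is the graph of `kMax` below. -/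
theorem maxGraph_singleValued (p : L2 × L2) (hp : p ∈ maxGraph) (h0 : p.1 = 0) : p.2 = 0 := by
  obtain ⟨f, g, h⟩ := hp
  have hf0 : EqOn f 0 (Ioi 0) := by
    refine Measure.eqOn_open_of_ae_eq (μ := volume) ?_ isOpen_Ioi
      (fun x hx => (h.hasDeriv x hx).continuousAt.continuousWithinAt) continuousOn_const
    filter_upwards [h.ae_eq, Lp.coeFn_zero ℂ 2 (volume.restrict (Ioi (0 : ℝ)))] with x h1 h2
    rw [← h1, h0, h2]
  have hg0 : EqOn g 0 (Ioi 0) := by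
    intro x hx
    have h1 : HasDerivAt (0 : ℝ → ℂ) (g x) x :=
      (h.hasDeriv x hx).congr_of_eventuallyEq
        ((hf0.eventuallyEq_of_mem (Ioi_mem_nhds hx)).symm)
    exact h1.unique (hasDerivAt_const x 0)
  refine Lp.ext ?_
  filter_upwards [h.ae_hasDeriv, ae_restrict_mem measurableSet_Ioi,
    Lp.coeFn_zero ℂ 2 (volume.restrict (Ioi (0 : ℝ)))] with x h1 hx h2
  have h3 : HasDerivAt (0 : ℝ → ℂ) (-(p.2 x)) x :=
    h1.congr_of_eventuallyEq ((hg0.eventuallyEq_of_mem (Ioi_mem_nhds hx)).symm)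
  have h4 : -(p.2 x) = 0 := h3.unique (hasDerivAt_const x 0)
  rw [h2]
  simpa using h4

theorem minGraph_le_maxGraph : minGraph ≤ maxGraph := by
  rintro p ⟨f, g, h, -, -⟩
  exact ⟨f, g, h⟩

/-- The maximal operator `K_max = -d²/dx²` on `L²(0, ∞)`. -/
def kMax : L2 →ₗ.[ℂ] L2 := maxGraph.toLinearPMap

/-- The minimal operator `K_min = -d²/dx²` on `L²(0, ∞)`. -/
def kMin : L2 →ₗ.[ℂ] L2 := minGraph.toLinearPMap

theorem kMax_graph : kMax.graph = maxGraph :=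
  Submodule.toLinearPMap_graph_eq _ maxGraph_singleValued

theorem kMin_graph : kMin.graph = minGraph :=
  Submodule.toLinearPMap_graph_eq _
    fun p hp => maxGraph_singleValued p (minGraph_le_maxGraph hp)

/-- The element `x ↦ e^{c x}` of `L²(0, ∞)` (it is `0` when this function is not in `L²`). -/
def expVec (c : ℂ) : L2 :=
  open Classical in
  if h : MemLp (fun x : ℝ => Complex.exp (c * x)) 2 (volume.restrict (Ioi (0 : ℝ))) then h.toLp
  else 0

/-- The principal square root. -/
def csqrt (z : ℂ) : ℂ := z ^ (1 / 2 : ℂ)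

/-- The solution `e^{i √w x}` of `-f'' = w f`, square integrable for `w` in the upper half-plane. -/
def psi (w : ℂ) : L2 := expVec (Complex.I * csqrt w)

/-- The normalized solution `2^{1/4} e^{i √i x}` of `-f'' = i f`. -/
def phiPlus : L2 := (((2 : ℝ) ^ (1 / 4 : ℝ) : ℝ) : ℂ) • expVec (Complex.I * csqrt Complex.I)

/-- The normalized square integrable solution `2^{1/4} e^{-i √(-i) x}` of `-f'' = -i f`; the
principal root `√(-i)` lies in the lower half-plane, whence the sign. -/
def phiMinus : L2 :=
  (((2 : ℝ) ^ (1 / 4 : ℝ) : ℝ) : ℂ) • expVec (-(Complex.I * csqrt (-Complex.I)))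

/-- The extension `K_α` of `K_min`: the operator `-d²/dx²` with domain
`dom K_min + span {α φ⁻ - φ⁺}`. -/
def kExt (α : ℂ) : L2 →ₗ.[ℂ] L2 :=
  kMax.domRestrict (kMin.domain ⊔ Submodule.span ℂ {α • phiMinus - phiPlus})

end HalfLine

section General

variable {H : Type*} [NormedAddCommGroup H] [InnerProductSpace ℂ H]

/-- The defect space `ran (T - w̄)ᗮ = ker (T* - w)` of an operator `T`. -/
def defectSpace (T : H →ₗ.[ℂ] H) (w : ℂ) : Submodule ℂ H :=
  (LinearMap.range (T.toFun - (starRingEnd ℂ w) • T.domain.subtype))ᗮ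

/-- For an operator `T` with deficiency indices `(1, 1)`: `ψ w` is a basis of the defect space at
each `w` in the upper half-plane, and `p`, `m` are orthonormal bases of the defect spaces at
`i` and `-i`. -/
structure IsDefectBasis (T : H →ₗ.[ℂ] H) (ψ : ℂ → H) (p m : H) : Prop where
  ne_zero : ∀ w : ℂ, 0 < w.im → ψ w ≠ 0
  span_eq : ∀ w : ℂ, 0 < w.im → defectSpace T w = Submodule.span ℂ {ψ w}
  norm_pos : ‖p‖ = 1
  span_pos : defectSpace T Complex.I = Submodule.span ℂ {p}
  norm_neg : ‖m‖ = 1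
  span_neg : defectSpace T (-Complex.I) = Submodule.span ℂ {m}

/-- The Livsic characteristic function `B(w) = (w - i)/(w + i) · A(w, i)⁻¹ A(w, -i)` where
`A(w, ±i)` is the inner product of `ψ w` with the normalized defect vector at `±i` (linear in
`ψ w`, which is the second argument of Mathlib's inner product). -/
def livsic (ψ : ℂ → H) (p m : H) (w : ℂ) : ℂ :=
  (w - Complex.I) / (w + Complex.I) * (inner ℂ p (ψ w))⁻¹ * inner ℂ m (ψ w)

end General

/-- The contractive analytic functions on the upper half-plane. -/
def IsSchurUpper (B : ℂ → ℂ) : Prop :=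
  DifferentiableOn ℂ B {w | 0 < w.im} ∧ ∀ w : ℂ, 0 < w.im → ‖B w‖ ≤ 1

theorem ofReal_add_I_ne_zero (s : ℝ) : (s : ℂ) + Complex.I ≠ 0 := by
  intro h
  simpa using congrArg Complex.im h

/-- The Cayley transform `s ↦ (s - i)/(s + i)` from the real line to the unit circle. -/
def cayleyReal (s : ℝ) : Metric.sphere (0 : ℂ) 1 :=
  ⟨((s : ℂ) - Complex.I) / (s + Complex.I), by
    have h : (s : ℂ) - Complex.I = (starRingEnd ℂ) ((s : ℂ) + Complex.I) := by simp [sub_eq_add_neg]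
    rw [mem_sphere_zero_iff_norm, norm_div, h, RCLike.norm_conj,
      div_self (norm_ne_zero_iff.mpr (ofReal_add_I_ne_zero s))]⟩

/-- The inverse Cayley transform `z ↦ i (1 + z)/(1 - z)`, from the disk to the upper half-plane. -/
def cayleyInv (z : ℂ) : ℂ := Complex.I * (1 + z) / (1 - z)

/-- `ν` is the Clark measure on the unit circle of `b` with parameter `α`: the Poisson integral of
`ν` is the real part of `(α + b)/(α - b)`, that is, `(1 - |b|²)/|α - b|²`. -/
def IsCircleClarkMeasure (b : ℂ → ℂ) (α : ℂ) (ν : Measure (Metric.sphere (0 : ℂ) 1)) : Prop :=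
  IsFiniteMeasure ν ∧ ∀ z : ℂ, ‖z‖ < 1 →
    ∫ t, (1 - ‖z‖ ^ 2) / ‖(t : ℂ) - z‖ ^ 2 ∂ν = ((α + b z) / (α - b z)).re

/-- `μ` is the Clark measure on the real line of the function `B` on the upper half-plane with
parameter `α`: the pullback under the Cayley transform of the Clark measure on the circle of the
function `b` with `B = b ∘ γ`. -/
def IsClarkMeasure (B : ℂ → ℂ) (α : ℂ) (μ : Measure ℝ) : Prop :=
  ∃ ν : Measure (Metric.sphere (0 : ℂ) 1),
    IsCircleClarkMeasure (fun z => B (cayleyInv z)) α ν ∧ μ = ν.comap cayleyReal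

namespace HalfLine

/-- The explicit polynomial in `s^{1/2}` in the denominator of the density. -/
def denomD (α : ℂ) (s : ℝ) : ℂ :=
  2 * (1 - (α.re : ℂ)) * (s : ℂ) ^ 2 + 2 * ((|s| : ℝ) : ℂ) + ((‖Complex.I * α - 1‖ ^ 2 : ℝ) : ℂ)
    - (((2 : ℝ) ^ (3 / 2 : ℝ) : ℝ) : ℂ) * (1 - (α.re : ℂ)) * (s : ℂ) ^ (3 / 2 : ℂ)
    + 2 * (1 - (α.re : ℂ) + (α.im : ℂ)) * (s : ℂ)
    - (((2 : ℝ) ^ (3 / 2 : ℝ) : ℝ) : ℂ) * (1 + (α.im : ℂ)) * (s : ℂ) ^ (1 / 2 : ℂ)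

/-- The density `2 Re √(2s) / (π (|s| + 1 + 2 Re (√s e^{-iπ/4})) D(s))`. -/
def weight (α : ℂ) (s : ℝ) : ℂ :=
  ((2 * (csqrt (2 * (s : ℂ))).re : ℝ) : ℂ) /
    (((Real.pi * (|s| + 1 +
        2 * (csqrt (s : ℂ) * Complex.exp (-(Complex.I * Real.pi / 4))).re) : ℝ) : ℂ) * denomD α s)

end HalfLine

end

/-! ### Absolutely continuous complex functions and the fundamental theorem of calculus -/

noncomputable section

/-! Put ρ = e^{iπ/4} (`root8`); then φ⁺ and φ⁻ are 2^{1/4} times exp(-ρ̄x) and exp(-ρx).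

Operators. Green's identity requires f' in L², which holds because otherwise |f|² would grow
linearly (`IsRep.memLp_deriv`). It shows that a decaying exponential solving -f'' = wf is orthogonal
to ran(K_min - w̄). Conversely, if G is orthogonal to that exponential, variation of constants
solves (K_min - w̄)u = G: orthogonality turns the dangerous term into an integral against a decaying
kernel, and a Schur test keeps u in L² (`exists_minGraph_of_inner_eq_zero`). Hence every defect
space is a line. For K_{1,α}, the boundary form vanishes because |α| = 1, and ran(K_{1,α} ± i) is
the whole space because αφ⁻ - φ⁺ supplies the one direction missing from ran(K_min ± i).

Characteristic function. Inner products of exponentials give the stated formula, and factoring w ∓ i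
reduces it to B = (√w - ρ)/(√w + ρ̄) (`livsic_eq`). The points ρ and -ρ̄ are mirror images in the
imaginary axis and Re √w > 0, so |B| < 1.

Clark measures. Existence is Herglotz's theorem, obtained from weak compactness; uniqueness holds
because a finite measure on the circle is the weak limit of the dilations of its Poisson integral.
Re (α + b)/(α - b) extends continuously to the circle off at most three points, so off these points
the Clark measure has the boundary values as its density (`restrict_compl_eq_withDensity`), and what
remains is singular. On the line the density becomes 2√2 Re √s / |α(√s + ρ̄) - (√s - ρ)|² times
1/(π(1 + s²)). For s > 0 the factorisation (s + 1 + √(2s))(s + 1 - √(2s)) = 1 + s² brings it to the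
stated form; for s ≤ 0 it vanishes since Re √s = 0. -/

theorem AbsolutelyContinuousOnInterval.ofReal {f : ℝ → ℝ} {a b : ℝ}
    (hf : AbsolutelyContinuousOnInterval f a b) :
    AbsolutelyContinuousOnInterval (fun x => (f x : ℂ)) a b := by
  have h1 : AbsolutelyContinuousOnInterval (fun _ : ℝ => (1 : ℂ)) a b :=
    (contDiffOn_const (c := (1 : ℂ)) (n := 1)).absolutelyContinuousOnInterval
  have h3 : (fun x => (f x : ℂ)) = f • fun _ : ℝ => (1 : ℂ) := by
    funext x
    simp
  rw [h3]
  exact hf.smul h1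

theorem IntervalIntegrable.absolutelyContinuousOnInterval_intervalIntegral_complex {p : ℝ → ℂ}
    {a b c : ℝ} (hp : IntervalIntegrable p volume a b) (hc : c ∈ uIcc a b) :
    AbsolutelyContinuousOnInterval (fun x => ∫ t in c..x, p t) a b := by
  have hre : IntervalIntegrable (fun t => (p t).re) volume a b :=
    ⟨hp.1.re, hp.2.re⟩
  have him : IntervalIntegrable (fun t => (p t).im) volume a b :=
    ⟨hp.1.im, hp.2.im⟩
  have h1 := (hre.absolutelyContinuousOnInterval_intervalIntegral hc).ofReal.add
    ((him.absolutelyContinuousOnInterval_intervalIntegral hc).ofReal.const_smul Complex.I)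
  rw [absolutelyContinuousOnInterval_iff] at h1 ⊢
  -- The ε-δ condition only sees values on the interval, so it is enough to recombine real and
  -- imaginary parts there.
  have key : ∀ x ∈ uIcc a b, (∫ t in c..x, p t) =
      ((fun x => ((∫ t in c..x, (p t).re : ℝ) : ℂ)) + fun x =>
        Complex.I • ((∫ t in c..x, (p t).im : ℝ) : ℂ)) x := by
    intro x hx
    have hpx : IntervalIntegrable p volume c x := hp.mono_set (uIcc_subset_uIcc hc hx)
    have h2 := Complex.reCLM.intervalIntegral_comp_comm hpx
    have h3 := Complex.imCLM.intervalIntegral_comp_comm hpx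
    simp only [Complex.reCLM_apply, Complex.imCLM_apply] at h2 h3
    simp only [Pi.add_apply, h2, h3, smul_eq_mul]
    rw [mul_comm, Complex.re_add_im]
  intro ε hε
  obtain ⟨δ, hδ, H⟩ := h1 ε hε
  refine ⟨δ, hδ, fun E hE hlt => ?_⟩
  have h4 := H E hE hlt
  convert h4 using 1
  refine Finset.sum_congr rfl fun i hi => ?_
  have h5 := hE.1 i hi
  rw [key _ h5.1, key _ h5.2]

/-- The fundamental theorem of calculus for absolutely continuous complex functions with an
integrable derivative. -/
theorem AbsolutelyContinuousOnInterval.integral_eq_sub_of_ae_hasDerivAt {f p : ℝ → ℂ} {a b : ℝ}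
    (hf : AbsolutelyContinuousOnInterval f a b)
    (hd : ∀ᵐ x, x ∈ uIcc a b → HasDerivAt f (p x) x)
    (hp : IntervalIntegrable p volume a b) : ∫ x in a..b, p x = f b - f a := by
  -- `f` minus the primitive of `p` has zero derivative almost everywhere, hence is constant.
  have h1 := hf.sub (hp.absolutelyContinuousOnInterval_intervalIntegral_complex
    (c := a) left_mem_uIcc)
  obtain ⟨C, hC⟩ := h1.const_of_ae_hasDerivAt_zero (by
    filter_upwards [hd, hp.ae_hasDerivAt_integral] with x hx1 hx2 hx
    simpa using! (hx1 hx).sub (hx2 hx a left_mem_uIcc))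
  have ha := hC a left_mem_uIcc
  have hb := hC b right_mem_uIcc
  simp only [Pi.sub_apply, intervalIntegral.integral_same, sub_zero] at ha hb
  rw [ha, ← hb]
  ring

namespace HalfLine

theorem ACLoc.mul {f g : ℝ → ℂ} (hf : ACLoc f) (hg : ACLoc g) : ACLoc (fun x => f x * g x) :=
  fun a b ha hab => (hf a b ha hab).smul (hg a b ha hab)

theorem ACLoc.of_contDiff {f : ℝ → ℂ} (hf : ContDiff ℝ 1 f) : ACLoc f :=
  fun _ _ _ _ => hf.contDiffOn.absolutelyContinuousOnInterval

theorem ACLoc.conj {f : ℝ → ℂ} (hf : ACLoc f) : ACLoc (fun x => starRingEnd ℂ (f x)) := by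
  intro a b ha hab
  have h := hf a b ha hab
  rw [absolutelyContinuousOnInterval_iff] at h ⊢
  simpa only [Complex.dist_conj_conj] using h

theorem hasDerivAt_conj {f : ℝ → ℂ} {f' : ℂ} {x : ℝ} (h : HasDerivAt f f' x) :
    HasDerivAt (fun y => starRingEnd ℂ (f y)) (starRingEnd ℂ f') x :=
  (Complex.conjCLE.toContinuousLinearMap.hasFDerivAt.comp_hasDerivAt x h)

theorem ACLoc.intervalIntegral {p : ℝ → ℂ} (hp : LocallyIntegrable p volume) :
    ACLoc (fun x => ∫ t in (0 : ℝ)..x, p t) := by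
  intro a b ha hab
  have h : IntervalIntegrable p volume 0 b :=
    (hp.integrableOn_isCompact isCompact_uIcc).intervalIntegrable
  refine (h.absolutelyContinuousOnInterval_intervalIntegral_complex left_mem_uIcc).mono ?_
  rw [uIcc_of_le hab, uIcc_of_le (ha.le.trans hab)]
  exact Icc_subset_Icc_left ha.le

theorem ACLoc.continuousOn {f : ℝ → ℂ} (hf : ACLoc f) : ContinuousOn f (Ioi 0) := by
  intro x hx
  have hx : 0 < x := hx
  have h := (hf (x / 2) (2 * x) (by linarith) (by linarith)).continuousOn
  rw [uIcc_of_le (by linarith)] at h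
  exact (h.continuousAt (Icc_mem_nhds (by linarith) (by linarith))).continuousWithinAt

theorem ACLoc.integral_eq_sub {f p : ℝ → ℂ} (hf : ACLoc f)
    (hd : ∀ᵐ x ∂(volume.restrict (Ioi (0 : ℝ))), HasDerivAt f (p x) x)
    {a b : ℝ} (ha : 0 < a) (hab : a ≤ b) (hp : IntervalIntegrable p volume a b) :
    ∫ x in a..b, p x = f b - f a := by
  refine (hf a b ha hab).integral_eq_sub_of_ae_hasDerivAt ?_ hp
  filter_upwards [(ae_restrict_iff' measurableSet_Ioi).mp hd] with x hx h
  rw [uIcc_of_le hab] at h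
  exact hx (lt_of_lt_of_le ha h.1)

theorem ACLoc.eq_add_integral {P p : ℝ → ℂ} {P₀ : ℂ} (hP : ACLoc P)
    (hd : ∀ᵐ x ∂(volume.restrict (Ioi (0 : ℝ))), HasDerivAt P (p x) x)
    (h0 : Tendsto P (𝓝[>] 0) (𝓝 P₀)) {X : ℝ} (hX : 0 < X)
    (hp : IntervalIntegrable p volume 0 X) : P X = P₀ + ∫ x in (0 : ℝ)..X, p x := by
  have hc : ContinuousWithinAt (fun a => ∫ x in X..a, p x) (Icc 0 X) 0 := by
    have := intervalIntegral.continuousOn_primitive_interval' hp right_mem_uIcc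
    rw [uIcc_of_le hX.le] at this
    exact this 0 ⟨le_rfl, hX.le⟩
  have hc' : Tendsto (fun a => ∫ x in X..a, p x) (𝓝[>] 0) (𝓝 (∫ x in X..(0 : ℝ), p x)) := by
    refine hc.tendsto.mono_left ?_
    rw [← nhdsWithin_Ioc_eq_nhdsGT hX]
    exact nhdsWithin_mono _ Ioc_subset_Icc_self
  have h2 : Tendsto (fun a => P a - P X) (𝓝[>] 0) (𝓝 (P₀ - P X)) := h0.sub_const _
  have h3 : (fun a => ∫ x in X..a, p x) =ᶠ[𝓝[>] 0] fun a => P a - P X := by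
    rw [← nhdsWithin_Ioc_eq_nhdsGT hX]
    filter_upwards [self_mem_nhdsWithin] with a ha
    rw [intervalIntegral.integral_symm, hP.integral_eq_sub hd ha.1 ha.2 (hp.mono_set ?_)]
    · ring
    · rw [uIcc_of_le ha.2, uIcc_of_le hX.le]
      exact Icc_subset_Icc_left ha.1.le
  have h4 := tendsto_nhds_unique (hc'.congr' h3) h2
  rw [intervalIntegral.integral_symm] at h4
  linear_combination h4

/-- A locally absolutely continuous integrable function with integrable derivative. -/
theorem ACLoc.integral_Ioi_eq {P p : ℝ → ℂ} {P₀ : ℂ} (hP : ACLoc P)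
    (hd : ∀ᵐ x ∂(volume.restrict (Ioi (0 : ℝ))), HasDerivAt P (p x) x)
    (hp : IntegrableOn p (Ioi 0)) (hi : IntegrableOn P (Ioi 0))
    (h0 : Tendsto P (𝓝[>] 0) (𝓝 P₀)) : ∫ x in Ioi (0 : ℝ), p x = -P₀ := by
  have h2 : Tendsto P atTop (𝓝 (P₀ + ∫ x in Ioi (0 : ℝ), p x)) := by
    have h3 := (intervalIntegral_tendsto_integral_Ioi 0 hp tendsto_id).const_add P₀
    refine h3.congr' ?_
    filter_upwards [eventually_gt_atTop 0] with X hX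
    refine (hP.eq_add_integral hd h0 hX ?_).symm
    rw [intervalIntegrable_iff_integrableOn_Ioc_of_le hX.le]
    exact hp.mono_set fun x hx => hx.1
  -- An integrable function with a limit at infinity has limit zero, because every half-line has
  -- infinite measure.
  have h3 := IntegrableAtFilter.eq_zero_of_tendsto (μ := volume) (l := atTop) (f := P)
    ⟨Ioi 0, Ioi_mem_atTop 0, hi⟩ (fun s hs => by
      obtain ⟨b, hb⟩ := mem_atTop_sets.mp hs
      exact measure_mono_top (fun x hx => hb x hx) (Real.volume_Ici (a := b))) h2
  linear_combination h3

/-- A locally absolutely continuous function with a limit at `0` is bounded near `0`. -/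
theorem ACLoc.integrableOn_norm_sq {g : ℝ → ℂ} {b : ℂ} (hg : ACLoc g)
    (h0 : Tendsto g (𝓝[>] 0) (𝓝 b)) (X : ℝ) (hX : 0 < X) :
    IntegrableOn (fun x => ‖g x‖ ^ 2) (Ioc 0 X) := by
  have hc : ContinuousOn (fun x => ‖g x‖ ^ 2) (Ioi 0) := hg.continuousOn.norm.pow 2
  have h1 : ContinuousOn (extendFrom (Ioo 0 X) fun x => ‖g x‖ ^ 2) (Icc 0 X) := by
    refine continuousOn_Icc_extendFrom_Ioo (la := ‖b‖ ^ 2) (lb := ‖g X‖ ^ 2)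
      (hc.mono Ioo_subset_Ioi_self) (h0.norm.pow 2) ?_
    exact (hc.continuousAt (Ioi_mem_nhds hX)).tendsto.mono_left nhdsWithin_le_nhds
  have h2 := h1.integrableOn_Icc (μ := volume)
  rw [integrableOn_Ioc_iff_integrableOn_Ioo]
  refine (h2.mono_set Ioo_subset_Icc_self).congr_fun (fun x hx => ?_) measurableSet_Ioo
  exact extendFrom_eq (subset_closure hx)
    ((hc.mono Ioo_subset_Ioi_self) x hx).tendsto

/-! ### Square integrability of the derivative and Green's identity -/

theorem IsRep.memLp {f g : ℝ → ℂ} {u v : L2} (h : IsRep f g u v) :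
    MemLp f 2 (volume.restrict (Ioi (0 : ℝ))) :=
  (memLp_congr_ae h.ae_eq).mp (Lp.memLp u)

/-- With P = g f̄ one has P' = |g|² - v f̄, where v f̄ is integrable. If the integral of |g|²
diverged, Re P = (|f|²)'/2 would eventually be at least 1, and |f|² would grow linearly,
contradicting f ∈ L². The limits at `0` control P and |g|² near the origin. -/
theorem IsRep.memLp_deriv {f g : ℝ → ℂ} {u v : L2} {a b : ℂ} (h : IsRep f g u v)
    (hf : Tendsto f (𝓝[>] 0) (𝓝 a)) (hg : Tendsto g (𝓝[>] 0) (𝓝 b)) :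
    MemLp g 2 (volume.restrict (Ioi (0 : ℝ))) := by
  have hfm := h.memLp
  have hvm : MemLp v 2 (volume.restrict (Ioi (0 : ℝ))) := Lp.memLp v
  have hgm : AEStronglyMeasurable g (volume.restrict (Ioi (0 : ℝ))) :=
    h.ac_deriv.continuousOn.aestronglyMeasurable measurableSet_Ioi
  have hf2 : IntegrableOn (fun x => ‖f x‖ ^ 2) (Ioi 0) :=
    (memLp_two_iff_integrable_sq_norm hfm.1).mp hfm
  have hconj : MemLp (fun x => starRingEnd ℂ (f x)) 2 (volume.restrict (Ioi (0 : ℝ))) := by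
    refine (memLp_congr_norm (Complex.continuous_conj.comp_aestronglyMeasurable hfm.1) hfm.1 ?_).mpr
      hfm
    exact Eventually.of_forall fun x => Complex.norm_conj _
  have hvf : IntegrableOn (fun x => v x * starRingEnd ℂ (f x)) (Ioi 0) := hvm.integrable_mul hconj
  rw [memLp_two_iff_integrable_sq_norm hgm]
  by_contra hcon
  set C : ℝ := ∫ x in Ioi (0 : ℝ), ‖v x * starRingEnd ℂ (f x)‖ with hC
  set P : ℝ → ℂ := fun x => g x * starRingEnd ℂ (f x) with hPdef
  have hPac : ACLoc P := h.ac_deriv.mul h.ac.conj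
  have hPd : ∀ᵐ x ∂(volume.restrict (Ioi (0 : ℝ))),
      HasDerivAt P (((‖g x‖ ^ 2 : ℝ) : ℂ) - v x * starRingEnd ℂ (f x)) x := by
    filter_upwards [h.ae_hasDeriv, ae_restrict_mem measurableSet_Ioi] with x h1 h2
    refine (h1.fun_mul (hasDerivAt_conj (h.hasDeriv x h2))).congr_deriv ?_
    rw [← Complex.normSq_eq_norm_sq, ← Complex.mul_conj]
    ring
  have hP0 : Tendsto P (𝓝[>] 0) (𝓝 (b * starRingEnd ℂ a)) :=
    hg.mul ((Complex.continuous_conj.tendsto a).comp hf)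
  have key : ∀ X : ℝ, 0 < X →
      (∫ x in (0 : ℝ)..X, ‖g x‖ ^ 2) ≤ (P X).re + ‖b * starRingEnd ℂ a‖ + C := by
    intro X hX
    have i1 : IntervalIntegrable (fun x => ‖g x‖ ^ 2) volume 0 X := by
      rw [intervalIntegrable_iff_integrableOn_Ioc_of_le hX.le]
      exact h.ac_deriv.integrableOn_norm_sq hg X hX
    have i2 : IntervalIntegrable (fun x => v x * starRingEnd ℂ (f x)) volume 0 X := by
      rw [intervalIntegrable_iff_integrableOn_Ioc_of_le hX.le]
      exact hvf.mono_set fun x hx => hx.1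
    have i3 : IntervalIntegrable (fun x => ((‖g x‖ ^ 2 : ℝ) : ℂ)) volume 0 X :=
      ⟨i1.1.ofReal, i1.2.ofReal⟩
    have h1 := hPac.eq_add_integral hPd hP0 hX (i3.sub i2)
    rw [intervalIntegral.integral_sub i3 i2, intervalIntegral.integral_ofReal] at h1
    have h2 := congrArg Complex.re h1
    simp only [Complex.add_re, Complex.sub_re, Complex.ofReal_re] at h2
    have h3 : ‖∫ x in (0 : ℝ)..X, v x * starRingEnd ℂ (f x)‖ ≤ C := by
      refine (intervalIntegral.norm_integral_le_integral_norm hX.le).trans ?_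
      rw [intervalIntegral.integral_of_le hX.le]
      exact setIntegral_mono_set hvf.norm (Eventually.of_forall fun _ => norm_nonneg _)
        (Eventually.of_forall fun x hx => hx.1)
    have h4 := (Complex.abs_re_le_norm (∫ x in (0 : ℝ)..X, v x * starRingEnd ℂ (f x))).trans h3
    have h5 := Complex.abs_re_le_norm (b * starRingEnd ℂ a)
    rw [abs_le] at h4 h5
    linarith
  have hub : ∃ X₀ : ℝ, 0 < X₀ ∧
      1 + ‖b * starRingEnd ℂ a‖ + C ≤ ∫ x in (0 : ℝ)..X₀, ‖g x‖ ^ 2 := by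
    by_contra! hb
    -- The endpoint `max i 1` keeps the interval nondegenerate for every `i`.
    refine hcon (integrableOn_Ioi_of_intervalIntegral_norm_bounded (l := atTop)
      (b := fun i : ℝ => max i 1) (1 + ‖b * starRingEnd ℂ a‖ + C) 0 (fun i => ?_)
      (tendsto_atTop_mono (fun i => le_max_left i 1) tendsto_id)
      (Eventually.of_forall fun i => ?_))
    · exact h.ac_deriv.integrableOn_norm_sq hg _ (lt_of_lt_of_le one_pos (le_max_right _ _))
    · simp only [norm_pow, norm_norm]
      exact (hb _ (lt_of_lt_of_le one_pos (le_max_right _ _))).le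
  obtain ⟨X₀, hX₀, hX₁⟩ := hub
  have hre : ∀ X, X₀ ≤ X → 1 ≤ (P X).re := by
    intro X hX
    have h1 := key X (hX₀.trans_le hX)
    have h2 : (∫ x in (0 : ℝ)..X₀, ‖g x‖ ^ 2) ≤ ∫ x in (0 : ℝ)..X, ‖g x‖ ^ 2 := by
      refine intervalIntegral.integral_mono_interval le_rfl hX₀.le hX
        (Eventually.of_forall fun x => by positivity) ?_
      rw [intervalIntegrable_iff_integrableOn_Ioc_of_le (hX₀.le.trans hX)]
      exact h.ac_deriv.integrableOn_norm_sq hg X (hX₀.trans_le hX)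
    linarith
  have hderiv : ∀ x, 0 < x → HasDerivAt (fun x => ‖f x‖ ^ 2) (2 * (P x).re) x := by
    intro x hx
    have h1 := (h.hasDeriv x hx).norm_sq
    convert h1 using 2
    rw [Complex.inner, hPdef]
  have hgrow : ∀ X, X₀ ≤ X → 2 * (X - X₀) ≤ ‖f X‖ ^ 2 - ‖f X₀‖ ^ 2 := by
    intro X hX
    refine (convex_Ici X₀).mul_sub_le_image_sub_of_le_deriv (f := fun x => ‖f x‖ ^ 2)
      (fun x hx => (hderiv x (hX₀.trans_le hx)).continuousAt.continuousWithinAt)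
      (fun x hx => (hderiv x ?_).differentiableAt.differentiableWithinAt) (fun x hx => ?_)
      X₀ self_mem_Ici X hX hX
    · rw [interior_Ici] at hx
      exact hX₀.trans hx
    · rw [interior_Ici] at hx
      rw [(hderiv x (hX₀.trans hx)).deriv]
      linarith [hre x (le_of_lt hx)]
  -- Beyond `X₀ + 1` the linear growth gives |f|² ≥ 2, so the constant 1 would be integrable on a
  -- half-line.
  have hone : IntegrableOn (fun _ : ℝ => (1 : ℝ)) (Ioi (X₀ + 1)) := by
    refine Integrable.mono (hf2.mono_set (Ioi_subset_Ioi (by linarith)))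
      aestronglyMeasurable_const ?_
    filter_upwards [ae_restrict_mem measurableSet_Ioi] with x hx
    have hx : X₀ + 1 < x := hx
    have := hgrow x (by linarith)
    rw [norm_one, Real.norm_of_nonneg (by positivity)]
    nlinarith [sq_nonneg ‖f X₀‖]
  rw [integrableOn_const_iff] at hone
  simp at hone

/-- Green's identity for functions with boundary values at `0`. -/
theorem IsRep.inner_sub_inner {f g f' g' : ℝ → ℂ} {u v u' v' : L2} {a b a' b' : ℂ}
    (h : IsRep f g u v) (h' : IsRep f' g' u' v')
    (hf : Tendsto f (𝓝[>] 0) (𝓝 a)) (hg : Tendsto g (𝓝[>] 0) (𝓝 b))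
    (hf' : Tendsto f' (𝓝[>] 0) (𝓝 a')) (hg' : Tendsto g' (𝓝[>] 0) (𝓝 b')) :
    inner ℂ u' v - inner ℂ v' u = b * starRingEnd ℂ a' - a * starRingEnd ℂ b' := by
  have hconj : ∀ {k : ℝ → ℂ}, MemLp k 2 (volume.restrict (Ioi (0 : ℝ))) →
      MemLp (fun x => starRingEnd ℂ (k x)) 2 (volume.restrict (Ioi (0 : ℝ))) := by
    intro k hk
    refine (memLp_congr_norm (Complex.continuous_conj.comp_aestronglyMeasurable hk.1) hk.1 ?_).mpr
      hk
    exact Eventually.of_forall fun x => Complex.norm_conj _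
  have hm := h.memLp
  have hm' := h'.memLp
  have hgm := h.memLp_deriv hf hg
  have hgm' := h'.memLp_deriv hf' hg'
  -- The function integrated is the Wronskian g f̄' - f ḡ' (primes for the second pair): the
  -- products g ḡ' cancel in its derivative. It is integrable because `g` and `g'` are in L².
  have key := (((h.ac_deriv.mul h'.ac.conj).add
      ((h.ac.mul h'.ac_deriv.conj).smul (-1))).integral_Ioi_eq
    (p := fun x => -(v x * starRingEnd ℂ (f' x) - f x * starRingEnd ℂ (v' x)))
    (P₀ := b * starRingEnd ℂ a' + (-1 : ℂ) • (a * starRingEnd ℂ b')) ?_ ?_ ?_ ?_)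
  · rw [integral_neg, neg_inj] at key
    rw [L2.inner_def, L2.inner_def, ← integral_sub (L2.integrable_inner _ _)
      (L2.integrable_inner _ _)]
    rw [smul_eq_mul, neg_one_mul, ← sub_eq_add_neg] at key
    rw [← key]
    refine integral_congr_ae ?_
    filter_upwards [h.ae_eq, h'.ae_eq] with x h1 h2
    simp only [RCLike.inner_apply, h1, h2]
  · filter_upwards [h.ae_hasDeriv, h'.ae_hasDeriv, ae_restrict_mem measurableSet_Ioi]
      with x h1 h2 hx
    refine ((h1.fun_mul (hasDerivAt_conj (h'.hasDeriv x hx))).add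
      (((h.hasDeriv x hx).fun_mul (hasDerivAt_conj h2)).const_smul (-1 : ℂ))).congr_deriv ?_
    simp only [map_neg, smul_eq_mul]
    ring
  · exact ((Lp.memLp v).integrable_mul (hconj hm')).sub
      (hm.integrable_mul (hconj (Lp.memLp v'))) |>.neg
  · exact (hgm.integrable_mul (hconj hm')).add ((hm.integrable_mul (hconj hgm')).smul (-1 : ℂ))
  · exact (hg.mul ((Complex.continuous_conj.tendsto _).comp hf')).add
      ((hf.mul ((Complex.continuous_conj.tendsto _).comp hg')).const_smul _)

end HalfLine

/-! ### A Schur test -/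

theorem lintegral_exp_neg_abs_lt_top {κ : ℝ} (hκ : 0 < κ) :
    ∫⁻ x : ℝ, ENNReal.ofReal (Real.exp (-κ * |x|)) < ⊤ := by
  have h1 : IntegrableOn (fun x : ℝ => Real.exp (-κ * |x|)) (Ioi 0) :=
    (integrableOn_exp_mul_Ioi (a := -κ) (by linarith) 0).congr_fun
      (fun x hx => by simp only [abs_of_pos (show 0 < x from hx)]) measurableSet_Ioi
  have h2 : IntegrableOn (fun x : ℝ => Real.exp (-κ * |x|)) (Iic 0) :=
    (integrableOn_exp_mul_Iic (a := κ) hκ 0).congr_fun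
      (fun x hx => by
        simp only [abs_of_nonpos (show x ≤ 0 from hx)]
        ring_nf) measurableSet_Iic
  have h3 : Integrable (fun x : ℝ => Real.exp (-κ * |x|)) := by
    rw [← integrableOn_univ, ← Iic_union_Ioi (a := (0 : ℝ))]
    exact h2.union h1
  exact (hasFiniteIntegral_iff_ofReal (Eventually.of_forall fun x => (Real.exp_pos _).le)).mp h3.2

/-- A Schur test for the kernel `exp (-κ |x - t|)`. -/
theorem memLp_two_of_enorm_le_lintegral_exp {κ : ℝ} (hκ : 0 < κ) {F G : ℝ → ℂ} {s : Set ℝ}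
    (hs : MeasurableSet s) (hF : AEStronglyMeasurable F (volume.restrict s)) (hG : MemLp G 2 volume)
    (h : ∀ x ∈ s, ‖F x‖ₑ ≤ ∫⁻ t, ENNReal.ofReal (Real.exp (-κ * |x - t|)) * ‖G t‖ₑ) :
    MemLp F 2 (volume.restrict s) := by
  set K : ℝ → ENNReal := fun x => ENNReal.ofReal (Real.exp (-κ * |x|)) with hK
  have hKm : Measurable K := by fun_prop
  set C := ∫⁻ x, K x with hC
  have hCtop : C < ⊤ := lintegral_exp_neg_abs_lt_top hκ
  have hG2 : ∫⁻ t, ‖G t‖ₑ ^ (2 : ℝ) < ⊤ := by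
    simpa using lintegral_rpow_enorm_lt_top_of_eLpNorm_lt_top (by simp) (by simp) hG.2
  have hGm : AEMeasurable (fun t => ‖G t‖ₑ) volume := hG.1.enorm
  refine ⟨hF, ?_⟩
  rw [eLpNorm_lt_top_iff_lintegral_rpow_enorm_lt_top (by simp) (by simp)]
  simp only [ENNReal.toReal_ofNat]
  have hsub : ∀ x, ∫⁻ t, K (x - t) = C := fun x => lintegral_sub_left_eq_self K x
  have hsub' : ∀ t, ∫⁻ x, K (x - t) = C := fun t => lintegral_sub_right_eq_self K t
  have hptw : ∀ x ∈ s, ‖F x‖ₑ ^ (2 : ℝ) ≤ C * ∫⁻ t, K (x - t) * ‖G t‖ₑ ^ (2 : ℝ) := by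
    intro x hx
    have hKx : Measurable fun t => K (x - t) := hKm.comp (measurable_const.sub measurable_id)
    -- Cauchy–Schwarz after writing the kernel as K^{1/2} · K^{1/2}; one factor integrates to `C`,
    -- and Tonelli later yields the second `C`.
    have h1 := ENNReal.lintegral_mul_le_Lp_mul_Lq volume
      (Real.HolderConjugate.two_two) (f := fun t => K (x - t) ^ (1 / 2 : ℝ))
      (g := fun t => K (x - t) ^ (1 / 2 : ℝ) * ‖G t‖ₑ) (hKx.pow_const _).aemeasurable
      ((hKx.pow_const _).aemeasurable.mul hGm)
    have h2 : ∀ t, ((fun t => K (x - t) ^ (1 / 2 : ℝ)) *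
        fun t => K (x - t) ^ (1 / 2 : ℝ) * ‖G t‖ₑ) t = K (x - t) * ‖G t‖ₑ := by
      intro t
      simp only [Pi.mul_apply]
      rw [← mul_assoc, ← ENNReal.rpow_add_of_nonneg _ _ (by norm_num) (by norm_num)]
      norm_num
    have h3 : ∀ t, (K (x - t) ^ (1 / 2 : ℝ)) ^ (2 : ℝ) = K (x - t) := by
      intro t
      rw [← ENNReal.rpow_mul]
      norm_num
    simp only [h2, ENNReal.mul_rpow_of_nonneg _ _ zero_le_two, h3, hsub] at h1
    calc ‖F x‖ₑ ^ (2 : ℝ) ≤ (C ^ (1 / 2 : ℝ) *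
          (∫⁻ t, K (x - t) * ‖G t‖ₑ ^ (2 : ℝ)) ^ (1 / 2 : ℝ)) ^ (2 : ℝ) :=
          ENNReal.rpow_le_rpow ((h x hx).trans h1) zero_le_two
      _ = _ := by
          rw [ENNReal.mul_rpow_of_nonneg _ _ zero_le_two, ← ENNReal.rpow_mul, ← ENNReal.rpow_mul]
          norm_num
  calc ∫⁻ x in s, ‖F x‖ₑ ^ (2 : ℝ)
      ≤ ∫⁻ x in s, C * ∫⁻ t, K (x - t) * ‖G t‖ₑ ^ (2 : ℝ) :=
        lintegral_mono_ae (by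
          filter_upwards [ae_restrict_mem hs] with x hx using hptw x hx)
    _ ≤ ∫⁻ x, C * ∫⁻ t, K (x - t) * ‖G t‖ₑ ^ (2 : ℝ) := setLIntegral_le_lintegral _ _
    _ = C * ∫⁻ x, ∫⁻ t, K (x - t) * ‖G t‖ₑ ^ (2 : ℝ) := lintegral_const_mul' _ _ hCtop.ne
    _ = C * ∫⁻ t, ∫⁻ x, K (x - t) * ‖G t‖ₑ ^ (2 : ℝ) := by
        rw [lintegral_lintegral_swap]
        refine AEMeasurable.mul (hKm.comp (measurable_fst.sub measurable_snd)).aemeasurable ?_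
        exact (hGm.pow_const _).comp_snd
    _ = C * ∫⁻ t, C * ‖G t‖ₑ ^ (2 : ℝ) := by
        congr 1
        refine lintegral_congr fun t => ?_
        rw [lintegral_mul_const _ (show Measurable fun x => K (x - t) by fun_prop), hsub']
    _ = C * (C * ∫⁻ t, ‖G t‖ₑ ^ (2 : ℝ)) := by rw [lintegral_const_mul' _ _ hCtop.ne]
    _ < ⊤ := ENNReal.mul_lt_top hCtop (ENNReal.mul_lt_top hCtop hG2)

/-! ### Exponentials and the range of the minimal operator -/

namespace HalfLine

theorem memLp_exp {c : ℂ} (hc : c.re < 0) :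
    MemLp (fun x : ℝ => Complex.exp (c * x)) 2 (volume.restrict (Ioi (0 : ℝ))) := by
  rw [memLp_two_iff_integrable_sq_norm (by fun_prop)]
  refine (integrableOn_exp_mul_Ioi (a := 2 * c.re) (by linarith) 0).congr_fun (fun x _ => ?_)
    measurableSet_Ioi
  simp only [Complex.norm_exp, Complex.re_mul_ofReal]
  rw [← Real.exp_nat_mul]
  push_cast
  ring_nf

theorem expVec_coeFn {c : ℂ} (hc : c.re < 0) :
    ∀ᵐ x ∂(volume.restrict (Ioi (0 : ℝ))), expVec c x = Complex.exp (c * x) := by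
  rw [expVec, dif_pos (memLp_exp hc)]
  exact (memLp_exp hc).coeFn_toLp

theorem inner_expVec {c d : ℂ} (hc : c.re < 0) (hd : d.re < 0) :
    inner ℂ (expVec c) (expVec d) = -(d + starRingEnd ℂ c)⁻¹ := by
  have hre : (d + starRingEnd ℂ c).re < 0 := by
    rw [Complex.add_re, Complex.conj_re]
    linarith
  have h := integral_exp_mul_complex_Ioi hre 0
  rw [L2.inner_def, ← one_div, ← neg_div]
  simp only [Complex.ofReal_zero, mul_zero, Complex.exp_zero] at h
  rw [← h]
  refine integral_congr_ae ?_
  filter_upwards [expVec_coeFn hc, expVec_coeFn hd] with x h1 h2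
  rw [RCLike.inner_apply, h1, h2, ← Complex.exp_conj, ← Complex.exp_add]
  simp only [map_mul, Complex.conj_ofReal]
  ring_nf

theorem hasDerivAt_exp_mul (c : ℂ) (x : ℝ) :
    HasDerivAt (fun x : ℝ => Complex.exp (c * x)) (c * Complex.exp (c * x)) x := by
  have h1 : HasDerivAt (fun x : ℝ => c * (x : ℂ)) c x := by
    simpa using (Complex.ofRealCLM.hasDerivAt (x := x)).const_mul c
  exact h1.cexp.congr_deriv (mul_comm _ _)

theorem contDiff_exp_mul (c : ℂ) : ContDiff ℝ 1 fun x : ℝ => Complex.exp (c * x) :=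
  (contDiff_const.mul Complex.ofRealCLM.contDiff).cexp

/-- The exponential `e^{c x}` solves `-f'' = -c² f`. -/
theorem isRep_exp {c : ℂ} (hc : c.re < 0) :
    IsRep (fun x => Complex.exp (c * x)) (fun x => c * Complex.exp (c * x)) (expVec c)
      ((-c ^ 2) • expVec c) where
  ae_eq := expVec_coeFn hc
  ac := ACLoc.of_contDiff (contDiff_exp_mul c)
  hasDeriv := fun x _ => hasDerivAt_exp_mul c x
  ac_deriv := ACLoc.of_contDiff (contDiff_const.mul (contDiff_exp_mul c))
  ae_hasDeriv := by
    filter_upwards [expVec_coeFn hc, Lp.coeFn_smul (-c ^ 2) (expVec c)] with x h1 h2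
    rw [h2, Pi.smul_apply, h1]
    refine ((hasDerivAt_exp_mul c x).const_mul c).congr_deriv ?_
    rw [smul_eq_mul]
    ring

theorem tendsto_exp_mul (c d : ℂ) :
    Tendsto (fun x : ℝ => d * Complex.exp (c * x)) (𝓝[>] 0) (𝓝 d) := by
  have h : Continuous fun x : ℝ => d * Complex.exp (c * x) := by fun_prop
  have h1 := (h.tendsto 0).mono_left (nhdsWithin_le_nhds (s := Ioi 0))
  simpa using h1

/-- Solution of `-f'' + k² f = G` with `f(0) = f'(0) = 0` for `G` orthogonal to
`e^{k̄ x}`, by variation of constants. -/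
theorem exists_minGraph_of_inner_eq_zero {k : ℂ} (hk : k.re < 0) (G : L2)
    (hG : inner ℂ (expVec (starRingEnd ℂ k)) G = 0) : ∃ u : L2, (u, G - k ^ 2 • u) ∈ minGraph := by
  set κ : ℝ := -k.re with hκ
  have hκ0 : 0 < κ := by linarith
  set g : ℝ → ℂ := (Ioi (0 : ℝ)).indicator G with hg
  have hgL : MemLp g 2 volume := (memLp_indicator_iff_restrict measurableSet_Ioi).mpr (Lp.memLp G)
  have hgl : LocallyIntegrable g volume := hgL.locallyIntegrable (by norm_num)
  set e : ℝ → ℂ := fun x => Complex.exp (k * x) with he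
  set e' : ℝ → ℂ := fun x => Complex.exp (-k * x) with he'
  have hec : Continuous e := by fun_prop
  have hec' : Continuous e' := by fun_prop
  have hee : ∀ x, e x * e' x = 1 := by
    intro x
    simp only [he, he', ← Complex.exp_add]
    simp
  have hne : ∀ x, ‖e x‖ = Real.exp (-κ * x) := by
    intro x
    simp [he, hκ, Complex.norm_exp]
  have hne' : ∀ x, ‖e' x‖ = Real.exp (κ * x) := by
    intro x
    simp [he', hκ, Complex.norm_exp]
  have hegl : LocallyIntegrable (fun t => e t * g t) volume := by
    have := hgl.continuous_smul hec
    simpa using this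
  -- The equation factors as (d/dx + k)(d/dx - k)f = -G. Here h = e^{-kx}q solves h' + kh = -G with
  -- h(0) = 0, and f = e^{kx}r below solves f' - kf = h with f(0) = 0, so f'(0) = 0 as well.
  set q : ℝ → ℂ := fun x => -∫ t in (0 : ℝ)..x, e t * g t with hq
  have hqac : ACLoc q := by
    have := (ACLoc.intervalIntegral hegl).smul (-1)
    convert this using 1
    funext x
    simp [hq]
  have hqd : ∀ᵐ x, HasDerivAt q (-(e x * g x)) x := by
    filter_upwards [LocallyIntegrable.ae_hasDerivAt_integral hegl] with x hx using (hx 0).neg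
  have hqc : Continuous q :=
    (intervalIntegral.continuous_primitive (fun a b =>
      (hegl.integrableOn_isCompact isCompact_uIcc).intervalIntegrable) 0).neg
  set h : ℝ → ℂ := fun x => e' x * q x with hh
  have hhc : Continuous h := hec'.mul hqc
  set r : ℝ → ℂ := fun x => ∫ t in (0 : ℝ)..x, e' t * h t with hr
  have hrd : ∀ x, HasDerivAt r (e' x * h x) x := fun x =>
    intervalIntegral.integral_hasDerivAt_right ((hec'.mul hhc).intervalIntegrable _ _)
      ((hec'.mul hhc).stronglyMeasurableAtFilter _ _) (hec'.mul hhc).continuousAt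
  set f : ℝ → ℂ := fun x => e x * r x with hf
  have hfd : ∀ x, HasDerivAt f (k * f x + h x) x := by
    intro x
    refine ((hasDerivAt_exp_mul k x).fun_mul (hrd x)).congr_deriv ?_
    have := hee x
    simp only [he] at this
    simp only [hf, he]
    linear_combination h x * this
  have hfc : Continuous f := continuous_iff_continuousAt.mpr fun x => (hfd x).continuousAt
  have hfac : ACLoc f := by
    refine ACLoc.of_contDiff (contDiff_one_iff_deriv.mpr ⟨fun x => (hfd x).differentiableAt, ?_⟩)
    rw [show deriv f = fun x => k * f x + h x from funext fun x => (hfd x).deriv]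
    fun_prop
  have hhac : ACLoc h := (ACLoc.of_contDiff (contDiff_exp_mul (-k))).mul hqac
  have hfdac : ACLoc (fun x => k * f x + h x) := (hfac.smul k).add hhac
  have hint : IntegrableOn (fun t => e t * g t) (Ioi 0) :=
    (memLp_exp hk).integrable_mul (hgL.restrict _)
  have htot : ∫ t in Ioi (0 : ℝ), e t * g t = 0 := by
    rw [L2.inner_def] at hG
    rw [← hG]
    refine integral_congr_ae ?_
    have hk' : (starRingEnd ℂ k).re < 0 := by simpa using hk
    filter_upwards [expVec_coeFn hk', ae_restrict_mem measurableSet_Ioi] with x h1 h2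
    rw [RCLike.inner_apply, h1, ← Complex.exp_conj]
    simp only [map_mul, Complex.conj_ofReal, Complex.conj_conj, he, hg, indicator_of_mem h2]
    ring
  -- Since e^{kt}G has total integral zero, q(x) is the integral over (x, ∞). Thus h(x) = ∫_x^∞
  -- e^{k(t-x)}G(t) dt, whose kernel has modulus e^{-κ(t-x)} despite the growing factor e^{-kx}.
  have hhm : MemLp h 2 (volume.restrict (Ioi (0 : ℝ))) := by
    refine memLp_two_of_enorm_le_lintegral_exp hκ0 measurableSet_Ioi hhc.aestronglyMeasurable hgL
      fun x hx => ?_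
    have hx : 0 < x := hx
    have h1 : q x = ∫ t in Ioi x, e t * g t := by
      have h2 := intervalIntegral.integral_interval_add_Ioi (f := fun t => e t * g t)
        (μ := volume) (a := 0) (b := x) hint
        (hint.mono_set (Ioi_subset_Ioi hx.le))
      rw [htot] at h2
      simp only [hq]
      linear_combination -h2
    have h3 : h x = ∫ t in Ioi x, e' x * (e t * g t) := by
      rw [integral_const_mul, ← h1]
    rw [h3]
    refine (enorm_integral_le_lintegral_enorm _).trans ?_
    refine le_trans ?_ (setLIntegral_le_lintegral (Ioi x) _)
    refine lintegral_mono_ae ?_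
    filter_upwards [ae_restrict_mem measurableSet_Ioi] with t ht
    have ht : x < t := ht
    rw [← mul_assoc, enorm_mul]
    gcongr
    rw [← ofReal_norm, norm_mul, hne, hne', ← Real.exp_add]
    apply ENNReal.ofReal_le_ofReal
    rw [abs_of_neg (by linarith)]
    apply Real.exp_le_exp.mpr
    linarith
  -- The kernel is now e^{k(x-t)} on 0 < t ≤ x, so the same test applies to `h`.
  have hfm : MemLp f 2 (volume.restrict (Ioi (0 : ℝ))) := by
    refine memLp_two_of_enorm_le_lintegral_exp hκ0 measurableSet_Ioi hfc.aestronglyMeasurable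
      ((memLp_indicator_iff_restrict measurableSet_Ioi).mpr hhm) fun x hx => ?_
    have hx : 0 < x := hx
    have h3 : f x = ∫ t in Ioc 0 x, e x * (e' t * h t) := by
      rw [integral_const_mul, ← intervalIntegral.integral_of_le hx.le]
    rw [h3]
    refine (enorm_integral_le_lintegral_enorm _).trans ?_
    refine le_trans ?_ (setLIntegral_le_lintegral (Ioc 0 x) _)
    refine lintegral_mono_ae ?_
    filter_upwards [ae_restrict_mem measurableSet_Ioc] with t ht
    rw [indicator_of_mem (show t ∈ Ioi (0 : ℝ) from ht.1), ← mul_assoc, enorm_mul]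
    gcongr
    rw [← ofReal_norm, norm_mul, hne, hne', ← Real.exp_add]
    apply ENNReal.ofReal_le_ofReal
    rw [abs_of_nonneg (by linarith [ht.2])]
    apply Real.exp_le_exp.mpr
    linarith
  refine ⟨hfm.toLp f, f, fun x => k * f x + h x, ⟨hfm.coeFn_toLp, hfac, fun x _ => hfd x, hfdac,
    ?_⟩, ?_, ?_⟩
  · filter_upwards [ae_restrict_of_ae hqd, ae_restrict_mem measurableSet_Ioi, hfm.coeFn_toLp,
      Lp.coeFn_sub G (k ^ 2 • hfm.toLp f), Lp.coeFn_smul (k ^ 2) (hfm.toLp f)]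
      with x h1 hx h2 h3 h4
    simp only [h3, Pi.sub_apply, h4, Pi.smul_apply, h2, smul_eq_mul]
    refine (((hfd x).const_mul k).add ((hasDerivAt_exp_mul (-k) x).fun_mul h1)).congr_deriv ?_
    have h5 := hee x
    simp only [he, he'] at h5
    simp only [hg, indicator_of_mem hx, hh, he, he']
    linear_combination (-(G x)) * h5
  · have := (hfc.tendsto 0).mono_left (nhdsWithin_le_nhds (s := Ioi 0))
    simpa [hf, hr] using this
  · have hc : Continuous fun x => k * f x + h x := (continuous_const.mul hfc).add hhc
    have := (hc.tendsto 0).mono_left (nhdsWithin_le_nhds (s := Ioi 0))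
    simpa [hf, hr, hh, hq] using this

end HalfLine

/-! ### Defect spaces and a criterion for self-adjointness -/

section General

variable {H : Type*} [NormedAddCommGroup H] [InnerProductSpace ℂ H]

theorem mem_defectSpace_iff {T : H →ₗ.[ℂ] H} {w : ℂ} {x : H} :
    x ∈ defectSpace T w ↔
      ∀ p ∈ T.graph, inner ℂ x (p.2 - starRingEnd ℂ w • p.1) = 0 := by
  rw [defectSpace, Submodule.mem_orthogonal']
  constructor
  · intro h p hp
    obtain ⟨y, hy1, hy2⟩ := T.mem_graph_iff.mp hp
    rw [← hy1, ← hy2]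
    exact h _ ⟨y, rfl⟩
  · rintro h _ ⟨y, rfl⟩
    exact h _ (T.mem_graph y)

/-- A symmetric operator with `ran (T ± i)` the whole space is self-adjoint. -/
theorem isSelfAdjoint_of_forall_exists_graph [CompleteSpace H] {T : H →ₗ.[ℂ] H}
    (hs : ∀ p ∈ T.graph, ∀ q ∈ T.graph, inner ℂ p.2 q.1 = inner ℂ p.1 q.2)
    (hp : ∀ y : H, ∃ p ∈ T.graph, p.2 + Complex.I • p.1 = y)
    (hm : ∀ y : H, ∃ p ∈ T.graph, p.2 - Complex.I • p.1 = y) : IsSelfAdjoint T := by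
  -- Write x orthogonal to the domain as Tp + ip. Then 0 = ⟨p, x⟩ = ⟨p, Tp⟩ + i‖p‖², and symmetry
  -- makes the first term real, so p = 0 and x = 0.
  have hdense : Dense (T.domain : Set H) := by
    rw [Submodule.dense_iff_topologicalClosure_eq_top, Submodule.topologicalClosure_eq_top_iff,
      Submodule.eq_bot_iff]
    intro x hx
    obtain ⟨p, hpg, rfl⟩ := hp x
    have h1 := (Submodule.mem_orthogonal _ _).mp hx p.1 (T.mem_domain_of_mem_graph hpg)
    have h2 := hs p hpg p hpg
    rw [inner_add_right, inner_smul_right, inner_self_eq_norm_sq_to_K] at h1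
    rw [← inner_conj_symm] at h2
    have h3 := congrArg Complex.im h1
    have h4 := congrArg Complex.im h2
    have h5 : ((‖p.1‖ : ℂ) ^ 2) = ((‖p.1‖ ^ 2 : ℝ) : ℂ) := by push_cast; rfl
    simp only [Complex.conj_im] at h4
    have h6 : ‖p.1‖ ^ 2 = 0 := by
      simp only [Complex.coe_algebraMap, h5, Complex.add_im, Complex.I_mul_im, Complex.ofReal_re,
        Complex.zero_im] at h3
      linarith
    have h7 : p.1 = 0 := by simpa using h6
    rw [T.graph_fst_eq_zero_snd (x := p.1) (x' := p.2) hpg h7, h7]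
    simp
  have hle : T ≤ T.adjoint := LinearPMap.IsFormalAdjoint.le_adjoint hdense
    fun x y => hs _ (T.mem_graph x) _ (T.mem_graph y)
  rw [LinearPMap.isSelfAdjoint_def]
  refine (LinearPMap.eq_of_le_of_domain_eq hle (le_antisymm hle.1 fun y hy => ?_)).symm
  -- Solve (T + i)p = (T* + i)y. Then y - p lies in ker(T* + i), which is orthogonal to ran(T - i),
  -- the whole space; so y = p lies in the domain of T.
  obtain ⟨p, hpg, hpy⟩ := hp (T.adjoint ⟨y, hy⟩ + Complex.I • y)
  have h1 : y - p.1 = 0 := by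
    obtain ⟨q, hqg, hqy⟩ := hm (y - p.1)
    have h2 : inner ℂ (T.adjoint ⟨y, hy⟩) q.1 = inner ℂ y q.2 := by
      obtain ⟨z, hz1, hz2⟩ := T.mem_graph_iff.mp hqg
      rw [← hz1, ← hz2]
      exact LinearPMap.adjoint_isFormalAdjoint hdense ⟨y, hy⟩ z
    have h3 := hs p hpg q hqg
    have h4 : T.adjoint ⟨y, hy⟩ = p.2 + Complex.I • p.1 - Complex.I • y := by
      rw [hpy]
      abel
    rw [h4] at h2
    have h5 : inner ℂ (y - p.1) (y - p.1) = 0 := by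
      nth_rewrite 2 [← hqy]
      simp only [inner_sub_left, inner_add_left, inner_sub_right, inner_smul_left,
        inner_smul_right, Complex.conj_I] at h2 ⊢
      linear_combination -h2 + h3
    exact inner_self_eq_zero.mp h5
  rw [sub_eq_zero.mp h1]
  exact T.mem_domain_of_mem_graph hpg

end General

/-! ### Principal square roots and the defect spaces of the minimal operator -/

namespace HalfLine

theorem csqrt_sq (z : ℂ) : csqrt z ^ 2 = z := by
  rw [csqrt, one_div]
  exact_mod_cast Complex.cpow_nat_inv_pow z two_ne_zero

theorem csqrt_re_nonneg (z : ℂ) : 0 ≤ (csqrt z).re := by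
  rw [csqrt]
  rcases eq_or_ne z 0 with rfl | hz
  · simp
  · rw [Complex.cpow_def_of_ne_zero hz, Complex.exp_re]
    refine mul_nonneg (Real.exp_pos _).le (Real.cos_nonneg_of_mem_Icc ?_)
    have h : (Complex.log z * (1 / 2)).im = z.arg / 2 := by
      rw [← Complex.log_im, show (1 / 2 : ℂ) = ((1 / 2 : ℝ) : ℂ) by push_cast; rfl,
        Complex.im_mul_ofReal]
      ring
    rw [h]
    constructor <;> linarith [Complex.neg_pi_lt_arg z, Complex.arg_le_pi z]

theorem csqrt_eq_of_sq_eq {z s : ℂ} (h : s ^ 2 = z) (hs : 0 < s.re) : csqrt z = s := by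
  have h1 : csqrt z ^ 2 = s ^ 2 := (csqrt_sq z).trans h.symm
  rcases sq_eq_sq_iff_eq_or_eq_neg.mp h1 with h2 | h2
  · exact h2
  · have h3 := csqrt_re_nonneg z
    rw [h2, Complex.neg_re] at h3
    linarith

theorem re_mul_im_csqrt (w : ℂ) : 2 * ((csqrt w).re * (csqrt w).im) = w.im := by
  have h := congrArg Complex.im (csqrt_sq w)
  rw [sq, Complex.mul_im] at h
  linarith

theorem csqrt_re_pos {w : ℂ} (hw : 0 < w.im) : 0 < (csqrt w).re := by
  rcases (csqrt_re_nonneg w).lt_or_eq with h | h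
  · exact h
  · have h1 := re_mul_im_csqrt w
    rw [← h] at h1
    linarith

theorem csqrt_im_pos {w : ℂ} (hw : 0 < w.im) : 0 < (csqrt w).im := by
  have h1 := re_mul_im_csqrt w
  have h2 := csqrt_re_pos hw
  by_contra! h
  nlinarith

theorem sqrt_two_mul_self : ((Real.sqrt 2 : ℝ) : ℂ) * (Real.sqrt 2 : ℝ) = 2 := by
  rw [← Complex.ofReal_mul, Real.mul_self_sqrt zero_le_two]
  push_cast
  rfl

theorem sqrt_two_ne_zero : ((Real.sqrt 2 : ℝ) : ℂ) ≠ 0 := by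
  exact_mod_cast (Real.sqrt_pos.mpr zero_lt_two).ne'

/-- The point `e^{iπ/4}`. -/
def root8 : ℂ := (1 + Complex.I) / (Real.sqrt 2 : ℝ)

theorem root8_sq : root8 ^ 2 = Complex.I := by
  have h := sqrt_two_mul_self
  rw [root8, div_pow, sq (((Real.sqrt 2 : ℝ) : ℂ)), h]
  linear_combination (1 / 2) * Complex.I_sq

theorem root8_re : root8.re = (Real.sqrt 2)⁻¹ := by
  rw [root8, Complex.div_ofReal_re]
  simp

theorem root8_im : root8.im = (Real.sqrt 2)⁻¹ := by
  rw [root8, Complex.div_ofReal_im]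
  simp

theorem conj_root8 : starRingEnd ℂ root8 = (1 - Complex.I) / (Real.sqrt 2 : ℝ) := by
  simp [root8, sub_eq_add_neg]

theorem conj_root8_sq : starRingEnd ℂ root8 ^ 2 = -Complex.I := by
  rw [← map_pow, root8_sq, Complex.conj_I]

theorem inv_sqrt_two_pos : 0 < (Real.sqrt 2)⁻¹ := inv_pos.mpr (Real.sqrt_pos.mpr zero_lt_two)

theorem csqrt_I : csqrt Complex.I = root8 :=
  csqrt_eq_of_sq_eq root8_sq (by rw [root8_re]; exact inv_sqrt_two_pos)

theorem csqrt_neg_I : csqrt (-Complex.I) = starRingEnd ℂ root8 :=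
  csqrt_eq_of_sq_eq conj_root8_sq (by rw [Complex.conj_re, root8_re]; exact inv_sqrt_two_pos)

theorem I_mul_root8 : Complex.I * root8 = -starRingEnd ℂ root8 := by
  rw [conj_root8, root8]
  field_simp
  linear_combination Complex.I_sq

theorem I_mul_conj_root8 : Complex.I * starRingEnd ℂ root8 = root8 := by
  rw [conj_root8, root8]
  field_simp
  linear_combination -Complex.I_sq

theorem phiPlus_eq : phiPlus = (((2 : ℝ) ^ (1 / 4 : ℝ) : ℝ) : ℂ) •
    expVec (-starRingEnd ℂ root8) := by
  rw [phiPlus, csqrt_I, I_mul_root8]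

theorem phiMinus_eq : phiMinus = (((2 : ℝ) ^ (1 / 4 : ℝ) : ℝ) : ℂ) • expVec (-root8) := by
  rw [phiMinus, csqrt_neg_I, I_mul_conj_root8]

theorem neg_root8_re : (-root8).re < 0 := by
  rw [Complex.neg_re, root8_re]
  linarith [inv_sqrt_two_pos]

theorem neg_conj_root8_re : (-starRingEnd ℂ root8).re < 0 := by
  rw [Complex.neg_re, Complex.conj_re, root8_re]
  linarith [inv_sqrt_two_pos]

theorem root8_add_conj : root8 + starRingEnd ℂ root8 = (Real.sqrt 2 : ℝ) := by
  rw [conj_root8, root8, ← add_div, div_eq_iff sqrt_two_ne_zero, sqrt_two_mul_self]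
  ring

/-- ‖e^{cx}‖² = -1/(2 Re c) = 1/√2, and the square of 2^{1/4} is √2. -/
theorem norm_smul_expVec {c : ℂ} (hc : c.re = -(Real.sqrt 2)⁻¹) :
    ‖(((2 : ℝ) ^ (1 / 4 : ℝ) : ℝ) : ℂ) • expVec c‖ = 1 := by
  have hc0 : c.re < 0 := by linarith [inv_sqrt_two_pos]
  have h1 : ((‖expVec c‖ : ℂ)) ^ 2 = (((Real.sqrt 2)⁻¹ : ℝ) : ℂ) := by
    have := inner_expVec hc0 hc0
    rw [inner_self_eq_norm_sq_to_K, Complex.add_conj, hc] at this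
    refine this.trans ?_
    rw [← Complex.ofReal_inv, ← Complex.ofReal_neg]
    congr 1
    have h2 : Real.sqrt 2 ≠ 0 := (Real.sqrt_pos.mpr zero_lt_two).ne'
    field_simp
    rw [Real.sq_sqrt zero_le_two]
  have h2 : ‖expVec c‖ ^ 2 = (Real.sqrt 2)⁻¹ := by exact_mod_cast h1
  have h3 : ((2 : ℝ) ^ (1 / 4 : ℝ)) ^ 2 = Real.sqrt 2 := by
    rw [← Real.rpow_natCast, ← Real.rpow_mul zero_le_two, Real.sqrt_eq_rpow]
    norm_num
  rw [norm_smul, Complex.norm_real, Real.norm_of_nonneg (by positivity),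
    ← sq_eq_sq₀ (by positivity) zero_le_one, mul_pow, h2, h3, one_pow]
  exact mul_inv_cancel₀ (Real.sqrt_pos.mpr zero_lt_two).ne'

theorem norm_phiPlus : ‖phiPlus‖ = 1 := by
  rw [phiPlus_eq]
  exact norm_smul_expVec (by rw [Complex.neg_re, Complex.conj_re, root8_re])

theorem norm_phiMinus : ‖phiMinus‖ = 1 := by
  rw [phiMinus_eq]
  exact norm_smul_expVec (by rw [Complex.neg_re, root8_re])

theorem expVec_ne_zero {c : ℂ} (hc : c.re < 0) : expVec c ≠ 0 := by
  intro h
  have h1 := inner_expVec hc hc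
  rw [h, inner_zero_left, Complex.add_conj, eq_comm, neg_eq_zero, inv_eq_zero] at h1
  have h2 : 2 * c.re = 0 := by exact_mod_cast h1
  linarith

/-- Green's identity for an element of the minimal graph and an exponential. -/
theorem inner_expVec_of_mem_minGraph {c : ℂ} (hc : c.re < 0) {p : L2 × L2} (hp : p ∈ minGraph) :
    inner ℂ (expVec c) p.2 = inner ℂ ((-c ^ 2) • expVec c) p.1 := by
  obtain ⟨f, g, h, hf, hg⟩ := hp
  have h1 := h.inner_sub_inner (isRep_exp hc) hf hg (by simpa using tendsto_exp_mul c 1)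
    (tendsto_exp_mul c c)
  rw [zero_mul, zero_mul, sub_zero] at h1
  exact sub_eq_zero.mp h1

/-- Green's identity puts the exponential in the defect space. For the other inclusion, a line in a
Hilbert space is its own double orthogonal complement, so it suffices that every `G` orthogonal to
`expVec c` lies in ran(K_min - w̄); take k = c̄, for which k² = -w̄. -/
theorem defectSpace_kMin {c w : ℂ} (hc : c.re < 0) (hw : c ^ 2 = -w) :
    defectSpace kMin w = Submodule.span ℂ {expVec c} := by
  apply le_antisymm
  · intro x hx
    rw [mem_defectSpace_iff, kMin_graph] at hx
    rw [← Submodule.orthogonal_orthogonal (Submodule.span ℂ {expVec c}),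
      Submodule.mem_orthogonal']
    intro G hG
    rw [Submodule.mem_orthogonal_singleton_iff_inner_right] at hG
    obtain ⟨u, hu⟩ := exists_minGraph_of_inner_eq_zero (k := starRingEnd ℂ c) (by simpa using hc) G
      (by rwa [Complex.conj_conj])
    have h1 := hx _ hu
    simp only at h1
    rwa [← map_pow, hw, map_neg, neg_smul, sub_neg_eq_add, add_sub_cancel_right] at h1
  · rw [Submodule.span_singleton_le_iff_mem, mem_defectSpace_iff, kMin_graph]
    intro p hp
    rw [inner_sub_right, inner_expVec_of_mem_minGraph hc hp, hw, neg_neg, inner_smul_left,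
      inner_smul_right, sub_self]

theorem psi_exponent_re {w : ℂ} (hw : 0 < w.im) : (Complex.I * csqrt w).re < 0 := by
  rw [Complex.I_mul_re]
  linarith [csqrt_im_pos hw]

theorem isDefectBasis_kMin : IsDefectBasis kMin psi phiPlus phiMinus where
  ne_zero := fun w hw => expVec_ne_zero (psi_exponent_re hw)
  span_eq := fun w hw => defectSpace_kMin (psi_exponent_re hw) (by
    rw [mul_pow, Complex.I_sq, csqrt_sq, neg_one_mul])
  norm_pos := norm_phiPlus
  span_pos := by
    rw [phiPlus_eq, Submodule.span_singleton_smul_eq (IsUnit.mk0 _ (by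
      exact_mod_cast (Real.rpow_pos_of_pos zero_lt_two _).ne'))]
    exact defectSpace_kMin neg_conj_root8_re (by rw [neg_sq, conj_root8_sq])
  norm_neg := norm_phiMinus
  span_neg := by
    rw [phiMinus_eq, Submodule.span_singleton_smul_eq (IsUnit.mk0 _ (by
      exact_mod_cast (Real.rpow_pos_of_pos zero_lt_two _).ne'))]
    exact defectSpace_kMin neg_root8_re (by rw [neg_sq, root8_sq, neg_neg])

/-! ### The extensions -/

/-- A representative of `α φ⁻ - φ⁺` with its boundary values. -/
theorem exists_isRep_boundary (α : ℂ) : ∃ (f g : ℝ → ℂ) (q : ℂ),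
    IsRep f g (α • phiMinus - phiPlus) (-Complex.I • (α • phiMinus + phiPlus)) ∧
    Tendsto f (𝓝[>] 0) (𝓝 (q * (α - 1))) ∧
    Tendsto g (𝓝[>] 0) (𝓝 (q * (starRingEnd ℂ root8 - α * root8))) ∧ starRingEnd ℂ q = q := by
  set q : ℂ := (((2 : ℝ) ^ (1 / 4 : ℝ) : ℝ) : ℂ) with hq
  have h1 := ((isRep_exp neg_root8_re).smul (α * q)).add
    ((isRep_exp neg_conj_root8_re).smul (-q))
  have e1 : (α * q) • expVec (-root8) + -q • expVec (-starRingEnd ℂ root8) =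
      α • phiMinus - phiPlus := by
    rw [phiMinus_eq, phiPlus_eq, ← hq, smul_smul, neg_smul, sub_eq_add_neg]
  have e2 : (α * q) • -(-root8) ^ 2 • expVec (-root8) +
      -q • -(-starRingEnd ℂ root8) ^ 2 • expVec (-starRingEnd ℂ root8) =
      -Complex.I • (α • phiMinus + phiPlus) := by
    rw [phiMinus_eq, phiPlus_eq, ← hq, neg_sq, root8_sq, neg_sq, conj_root8_sq]
    module
  rw [e1, e2] at h1
  refine ⟨_, _, q, h1, ?_, ?_, Complex.conj_ofReal _⟩
  · have h2 := (tendsto_exp_mul (-root8) (α * q)).add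
      (tendsto_exp_mul (-starRingEnd ℂ root8) (-q))
    rw [show α * q + -q = q * (α - 1) by ring] at h2
    exact h2
  · have h2 := ((tendsto_exp_mul (-root8) (-root8)).const_smul (α * q)).add
      ((tendsto_exp_mul (-starRingEnd ℂ root8) (-starRingEnd ℂ root8)).const_smul (-q))
    rw [show (α * q) • -root8 + -q • -starRingEnd ℂ root8 =
      q * (starRingEnd ℂ root8 - α * root8) by simp only [smul_eq_mul]; ring] at h2
    exact h2

/-- Since K_max φ^± = ±i φ^±, the vector αφ⁻ - φ⁺ is sent to -i(αφ⁻ + φ⁺). Single-valuedness of the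
maximal graph then turns the decomposition of the domain into one of the graph. -/
theorem mem_kExt_graph_iff {α : ℂ} {p : L2 × L2} : p ∈ (kExt α).graph ↔
    ∃ p₀ ∈ minGraph, ∃ c : ℂ,
      p = p₀ + c • (α • phiMinus - phiPlus, -Complex.I • (α • phiMinus + phiPlus)) := by
  obtain ⟨f, g, q, hrep, -⟩ := exists_isRep_boundary α
  have hχ : (α • phiMinus - phiPlus, -Complex.I • (α • phiMinus + phiPlus)) ∈ maxGraph :=
    ⟨f, g, hrep⟩
  have hmin : ∀ u, u ∈ kMin.domain ↔ ∃ v, (u, v) ∈ minGraph := by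
    intro u
    rw [LinearPMap.mem_domain_iff, kMin_graph]
  have hext : p ∈ (kExt α).graph ↔ p ∈ maxGraph ∧
      p.1 ∈ kMin.domain ⊔ Submodule.span ℂ {α • phiMinus - phiPlus} := by
    rw [← kMax_graph, LinearPMap.mem_graph_iff, LinearPMap.mem_graph_iff]
    constructor
    · rintro ⟨y, h1, h2⟩
      refine ⟨⟨⟨y, y.2.2⟩, h1, h2⟩, h1 ▸ y.2.1⟩
    · rintro ⟨⟨y, h1, h2⟩, h3⟩
      exact ⟨⟨y, ⟨h1.symm ▸ h3, y.2⟩⟩, h1, h2⟩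
  rw [hext]
  constructor
  · rintro ⟨h1, h2⟩
    obtain ⟨u, hu, z, hz, hsum⟩ := Submodule.mem_sup.mp h2
    obtain ⟨c, rfl⟩ := Submodule.mem_span_singleton.mp hz
    obtain ⟨v, huv⟩ := (hmin u).mp hu
    refine ⟨(u, v), huv, c, ?_⟩
    have h3 := maxGraph.sub_mem h1 (maxGraph.add_mem (minGraph_le_maxGraph huv)
      (maxGraph.smul_mem c hχ))
    have h4 := maxGraph_singleValued _ h3 (by
      simp only [Prod.fst_sub, Prod.fst_add, Prod.smul_fst, hsum, sub_self])
    refine Prod.ext hsum.symm ?_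
    exact sub_eq_zero.mp h4
  · rintro ⟨p₀, hp₀, c, rfl⟩
    refine ⟨maxGraph.add_mem (minGraph_le_maxGraph hp₀) (maxGraph.smul_mem c hχ), ?_⟩
    exact Submodule.mem_sup.mpr ⟨p₀.1, (hmin _).mpr ⟨p₀.2, hp₀⟩, _,
      Submodule.mem_span_singleton.mpr ⟨c, rfl⟩, rfl⟩

theorem kMin_le_kExt (α : ℂ) : kMin ≤ kExt α := by
  rw [← LinearPMap.le_graph_iff, kMin_graph]
  intro p hp
  exact mem_kExt_graph_iff.mpr ⟨p, hp, 0, by simp⟩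

/-- Minimal elements have no boundary data, so Green's identity leaves only the boundary form of αφ⁻
- φ⁺ with itself, a multiple of |α|² - 1. -/
theorem kExt_symmetric {α : ℂ} (hα : ‖α‖ = 1) (p : L2 × L2) (hp : p ∈ (kExt α).graph)
    (p' : L2 × L2) (hp' : p' ∈ (kExt α).graph) : inner ℂ p.2 p'.1 = inner ℂ p.1 p'.2 := by
  obtain ⟨⟨u, v⟩, ⟨f, g, h, hf, hg⟩, c, rfl⟩ := mem_kExt_graph_iff.mp hp
  obtain ⟨⟨u', v'⟩, ⟨f', g', h', hf', hg'⟩, c', rfl⟩ := mem_kExt_graph_iff.mp hp'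
  obtain ⟨fχ, gχ, q, hχ, hfχ, hgχ, hq⟩ := exists_isRep_boundary α
  have key := (h'.add (hχ.smul c')).inner_sub_inner (h.add (hχ.smul c))
    (hf'.add (hfχ.const_smul c')) (hg'.add (hgχ.const_smul c'))
    (hf.add (hfχ.const_smul c)) (hg.add (hgχ.const_smul c))
  have hαα : α * starRingEnd ℂ α = 1 := by
    rw [Complex.mul_conj, Complex.normSq_eq_norm_sq, hα]
    simp
  have h0 : (0 + c' • (q * (starRingEnd ℂ root8 - α * root8))) *
      starRingEnd ℂ (0 + c • (q * (α - 1))) - (0 + c' • (q * (α - 1))) *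
      starRingEnd ℂ (0 + c • (q * (starRingEnd ℂ root8 - α * root8))) = 0 := by
    simp only [zero_add, smul_eq_mul, map_mul, map_sub, map_one, Complex.conj_conj, hq]
    linear_combination (c' * q ^ 2 * starRingEnd ℂ c *
      (starRingEnd ℂ root8 - root8)) * hαα
  rw [h0] at key
  exact (sub_eq_zero.mp key).symm

theorem exists_add_smul_of_norm_eq_one {φ : L2} (hφ : ‖φ‖ = 1) (y : L2) :
    ∃ (G : L2) (c : ℂ), inner ℂ φ G = 0 ∧ y = G + c • φ := by
  refine ⟨y - inner ℂ φ y • φ, inner ℂ φ y, ?_, by abel⟩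
  rw [inner_sub_right, inner_smul_right, inner_self_eq_norm_sq_to_K, hφ]
  simp

theorem inner_expVec_eq_zero_of_inner_smul {c q : ℂ} (hq : q ≠ 0) {G : L2}
    (h : inner ℂ (q • expVec c) G = 0) : inner ℂ (expVec c) G = 0 := by
  rw [inner_smul_left, mul_eq_zero] at h
  exact h.resolve_left (by simpa using hq)

theorem isSelfAdjoint_kExt {α : ℂ} (hα : ‖α‖ = 1) : IsSelfAdjoint (kExt α) := by
  have hq : (((2 : ℝ) ^ (1 / 4 : ℝ) : ℝ) : ℂ) ≠ 0 := by
    exact_mod_cast (Real.rpow_pos_of_pos zero_lt_two _).ne'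
  have hαα : starRingEnd ℂ α * α = 1 := by
    rw [mul_comm, Complex.mul_conj, Complex.normSq_eq_norm_sq, hα]
    simp
  refine isSelfAdjoint_of_forall_exists_graph (kExt_symmetric hα) (fun y => ?_) fun y => ?_
  · obtain ⟨G, c, hG, rfl⟩ := exists_add_smul_of_norm_eq_one norm_phiPlus y
    rw [phiPlus_eq] at hG
    obtain ⟨u, hu⟩ := exists_minGraph_of_inner_eq_zero (k := -root8) neg_root8_re G (by
      rw [map_neg]
      exact inner_expVec_eq_zero_of_inner_smul hq hG)
    rw [neg_sq, root8_sq] at hu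
    -- (K + i)(αφ⁻ - φ⁺) = -2iφ⁺, so the coefficient ci/2 produces cφ⁺.
    refine ⟨_, mem_kExt_graph_iff.mpr ⟨_, hu, c * Complex.I / 2, rfl⟩, ?_⟩
    simp only [Prod.snd_add, Prod.fst_add, Prod.smul_snd, Prod.smul_fst]
    match_scalars
    · ring
    · ring
    · ring
    · linear_combination (-c) * Complex.I_sq
  · obtain ⟨G, c, hG, rfl⟩ := exists_add_smul_of_norm_eq_one norm_phiMinus y
    rw [phiMinus_eq] at hG
    obtain ⟨u, hu⟩ := exists_minGraph_of_inner_eq_zero (k := -starRingEnd ℂ root8)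
      neg_conj_root8_re G (by
      rw [map_neg, Complex.conj_conj]
      exact inner_expVec_eq_zero_of_inner_smul hq hG)
    rw [neg_sq, conj_root8_sq] at hu
    -- (K - i)(αφ⁻ - φ⁺) = -2iαφ⁻, so the coefficient ciᾱ/2 produces cφ⁻.
    refine ⟨_, mem_kExt_graph_iff.mpr ⟨_, hu, c * Complex.I * starRingEnd ℂ α / 2, rfl⟩, ?_⟩
    simp only [Prod.snd_add, Prod.fst_add, Prod.smul_snd, Prod.smul_fst]
    match_scalars
    · ring
    · ring
    · linear_combination (-c * starRingEnd ℂ α * α) * Complex.I_sq + c * hαα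
    · ring

end HalfLine

/-! ### The Cayley transform and arc length -/

theorem continuous_cayleyReal : Continuous cayleyReal := by
  refine Continuous.subtype_mk ?_ _
  exact (Complex.continuous_ofReal.sub continuous_const).div
    (Complex.continuous_ofReal.add continuous_const) ofReal_add_I_ne_zero

theorem cayleyReal_coe (s : ℝ) : (cayleyReal s : ℂ) = (s - Complex.I) / (s + Complex.I) := rfl

theorem cayleyReal_ne_one (s : ℝ) : (cayleyReal s : ℂ) ≠ 1 := by
  rw [cayleyReal_coe, Ne, div_eq_one_iff_eq (ofReal_add_I_ne_zero s)]
  intro h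
  have := congrArg Complex.im h
  norm_num at this

theorem cayleyInv_cayleyReal (s : ℝ) : cayleyInv (cayleyReal s) = s := by
  have h1 := ofReal_add_I_ne_zero s
  rw [cayleyInv, div_eq_iff (sub_ne_zero.mpr (cayleyReal_ne_one s).symm), cayleyReal_coe]
  field_simp
  ring

theorem cayleyReal_injective : Function.Injective cayleyReal := by
  intro s t h
  have h1 := cayleyInv_cayleyReal s
  rw [h, cayleyInv_cayleyReal] at h1
  exact_mod_cast h1.symm

theorem measurableEmbedding_cayleyReal : MeasurableEmbedding cayleyReal :=
  continuous_cayleyReal.measurableEmbedding cayleyReal_injective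

/-- The density of the harmonic measure of the upper half-plane at `i`. -/
def cauchyDensity (s : ℝ) : ℝ := 1 / (Real.pi * (1 + s ^ 2))

theorem cauchyDensity_nonneg (s : ℝ) : 0 ≤ cauchyDensity s := by
  have := Real.pi_pos
  rw [cauchyDensity]
  positivity

theorem measurable_cauchyDensity : Measurable cauchyDensity := by
  unfold cauchyDensity
  fun_prop

/-- The normalized arc length measure on the unit circle. -/
def arcMeasure : Measure (Metric.sphere (0 : ℂ) 1) :=
  (volume.withDensity fun s => ENNReal.ofReal (cauchyDensity s)).map cayleyReal

theorem circleMap_arctan (s : ℝ) :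
    circleMap 0 1 (Real.pi + 2 * Real.arctan s) = (cayleyReal s : ℂ) := by
  have h1 : (0 : ℝ) < 1 + s ^ 2 := by positivity
  have h4 : Real.cos (2 * Real.arctan s) = (1 - s ^ 2) / (1 + s ^ 2) := by
    rw [Real.cos_two_mul, Real.cos_sq_arctan]
    field_simp
    ring
  have h5 : Real.sin (2 * Real.arctan s) = 2 * s / (1 + s ^ 2) := by
    rw [Real.sin_two_mul, Real.sin_arctan, Real.cos_arctan]
    have h6 : Real.sqrt (1 + s ^ 2) ^ 2 = 1 + s ^ 2 := Real.sq_sqrt h1.le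
    calc 2 * (s / Real.sqrt (1 + s ^ 2)) * (1 / Real.sqrt (1 + s ^ 2))
        = 2 * s / Real.sqrt (1 + s ^ 2) ^ 2 := by ring
      _ = _ := by rw [h6]
  rw [cayleyReal_coe, eq_div_iff (ofReal_add_I_ne_zero s), circleMap, Complex.ofReal_one, one_mul,
    zero_add, Complex.exp_mul_I, ← Complex.ofReal_cos, ← Complex.ofReal_sin, add_comm Real.pi,
    Real.cos_add_pi, Real.sin_add_pi, h4, h5]
  have h8 : (1 + (s : ℂ) ^ 2) ≠ 0 := by exact_mod_cast h1.ne'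
  push_cast
  field_simp
  linear_combination (-2 * (s : ℂ)) * Complex.I_sq

/-- Substitute θ = π + 2 arctan s, so that dθ/2π = ds/(π(1 + s²)). This identifies `arcMeasure` with
normalised arc length; the Cayley transform misses only the point 1. -/
theorem circleAverage_eq_integral_arcMeasure {E : Type*} [NormedAddCommGroup E] [NormedSpace ℝ E]
    (F : ℂ → E) : Real.circleAverage F 0 1 = ∫ t, F t ∂arcMeasure := by
  have hinj : InjOn (fun s : ℝ => Real.pi + 2 * Real.arctan s) univ := by
    intro s _ t _ h
    exact Real.arctan_injective (by simpa using h)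
  have himg : (fun s : ℝ => Real.pi + 2 * Real.arctan s) '' univ = Ioo 0 (2 * Real.pi) := by
    ext θ
    constructor
    · rintro ⟨s, -, rfl⟩
      have h1 := Real.neg_pi_div_two_lt_arctan s
      have h2 := Real.arctan_lt_pi_div_two s
      constructor <;> simp only <;> linarith
    · rintro ⟨h1, h2⟩
      refine ⟨Real.tan ((θ - Real.pi) / 2), mem_univ _, ?_⟩
      simp only
      rw [Real.arctan_tan (by linarith) (by linarith)]
      ring
  have hderiv : ∀ s ∈ (univ : Set ℝ), HasDerivWithinAt
      (fun s : ℝ => Real.pi + 2 * Real.arctan s) (2 * (1 / (1 + s ^ 2))) univ s := fun s _ =>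
    (((Real.hasDerivAt_arctan s).const_mul 2).const_add _).hasDerivWithinAt
  have hcv := integral_image_eq_integral_abs_deriv_smul MeasurableSet.univ hderiv hinj
    (fun θ => F (circleMap 0 1 θ))
  rw [himg] at hcv
  rw [Real.circleAverage_def, intervalIntegral.integral_of_le (by positivity),
    integral_Ioc_eq_integral_Ioo, hcv, arcMeasure, measurableEmbedding_cayleyReal.integral_map,
    integral_withDensity_eq_integral_toReal_smul measurable_cauchyDensity.ennreal_ofReal
      (Eventually.of_forall fun _ => ENNReal.ofReal_lt_top), ← integral_smul, setIntegral_univ]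
  refine integral_congr_ae (Eventually.of_forall fun s => ?_)
  simp only
  rw [circleMap_arctan, smul_smul, ENNReal.toReal_ofReal (cauchyDensity_nonneg s), cauchyDensity,
    abs_of_pos (by positivity)]
  congr 1
  have := Real.pi_pos.ne'
  field_simp

instance : IsProbabilityMeasure arcMeasure := by
  have h := circleAverage_eq_integral_arcMeasure (fun _ => (1 : ℝ))
  rw [Real.circleAverage_const] at h
  simp only [integral_const, smul_eq_mul, mul_one] at h
  refine ⟨?_⟩
  rw [Measure.real, eq_comm, ENNReal.toReal_eq_one_iff] at h
  exact h

/-! ### Poisson integrals of measures on the circle -/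

theorem Continuous.integrable_sphere {E : Type*} [NormedAddCommGroup E]
    {f : Metric.sphere (0 : ℂ) 1 → E} (hf : Continuous f)
    (ν : Measure (Metric.sphere (0 : ℂ) 1)) [IsFiniteMeasure ν] : Integrable f ν :=
  hf.integrable_of_hasCompactSupport (HasCompactSupport.of_compactSpace f)

/-- The Poisson kernel of the unit disk. -/
def poisson (t z : ℂ) : ℝ := (1 - ‖z‖ ^ 2) / ‖t - z‖ ^ 2

theorem norm_coe_sphere_eq_one (t : Metric.sphere (0 : ℂ) 1) : ‖(t : ℂ)‖ = 1 := by
  simp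

theorem sphere_sub_ne_zero (t : Metric.sphere (0 : ℂ) 1) {z : ℂ} (hz : ‖z‖ < 1) :
    (t : ℂ) - z ≠ 0 := by
  intro h
  rw [← sub_eq_zero.mp h, norm_coe_sphere_eq_one] at hz
  exact lt_irrefl _ hz

theorem poisson_nonneg (t : ℂ) {z : ℂ} (hz : ‖z‖ < 1) : 0 ≤ poisson t z := by
  have : ‖z‖ ^ 2 ≤ 1 := pow_le_one₀ (norm_nonneg z) hz.le
  exact div_nonneg (by linarith) (by positivity)

theorem continuous_poisson {z : ℂ} (hz : ‖z‖ < 1) :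
    Continuous fun t : Metric.sphere (0 : ℂ) 1 => poisson t z := by
  refine continuous_const.div (by fun_prop) fun t => ?_
  exact pow_ne_zero _ (norm_ne_zero_iff.mpr (sphere_sub_ne_zero t hz))

theorem norm_smul_coe_lt_one {r : ℝ} (h0 : 0 ≤ r) (h1 : r < 1) (t : Metric.sphere (0 : ℂ) 1) :
    ‖(r : ℂ) * t‖ < 1 := by
  rwa [norm_mul, norm_coe_sphere_eq_one, mul_one, Complex.norm_real, Real.norm_of_nonneg h0]

/-- |t' - rt| = |t - rt'| for unit `t`, `t'`. With Fubini this moves the dilation from the measure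
to the test function. -/
theorem poisson_symm (r : ℝ) (t t' : Metric.sphere (0 : ℂ) 1) :
    poisson t' (r * t) = poisson t (r * t') := by
  have h1 := norm_coe_sphere_eq_one t
  have h2 := norm_coe_sphere_eq_one t'
  have h3 : ‖(t' : ℂ) - r * t‖ ^ 2 = ‖(t : ℂ) - r * t'‖ ^ 2 := by
    rw [Complex.sq_norm, Complex.sq_norm]
    have h4 : Complex.normSq (t : ℂ) = 1 := by rw [← Complex.sq_norm, h1, one_pow]
    have h5 : Complex.normSq (t' : ℂ) = 1 := by rw [← Complex.sq_norm, h2, one_pow]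
    rw [Complex.normSq_apply] at h4 h5 ⊢
    rw [Complex.normSq_apply]
    simp only [Complex.sub_re, Complex.sub_im, Complex.re_ofReal_mul, Complex.im_ofReal_mul]
    linear_combination (1 - r ^ 2) * h5 - (1 - r ^ 2) * h4
  rw [poisson, poisson, h3, norm_mul, norm_mul, h1, h2]

theorem integral_poisson_mul_re {f : ℂ → ℂ} (hf : DiffContOnCl ℂ f (Metric.ball 0 1)) {z : ℂ}
    (hz : ‖z‖ < 1) :
    ∫ t : Metric.sphere (0 : ℂ) 1, poisson t z * (f t).re ∂arcMeasure = (f z).re := by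
  have hc : ContinuousOn f (Metric.closedBall 0 1) := by
    have := hf.2
    rwa [closure_ball _ one_ne_zero] at this
  have hcs : Continuous fun t : Metric.sphere (0 : ℂ) 1 => f t :=
    hc.comp_continuous continuous_subtype_val fun t => Metric.sphere_subset_closedBall t.2
  have h1 := hf.circleAverage_poissonKernel_smul' (w := z) (by simpa using hz)
  rw [circleAverage_eq_integral_arcMeasure] at h1
  have h2 : ∀ t : Metric.sphere (0 : ℂ) 1,
      ((‖(t : ℂ) - 0‖ ^ 2 - ‖z - 0‖ ^ 2) / ‖(t : ℂ) - 0 - (z - 0)‖ ^ 2) • f t =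
        poisson t z • f t := by
    intro t
    rw [sub_zero, sub_zero, norm_coe_sphere_eq_one, one_pow, poisson]
  simp only [h2] at h1
  rw [← h1]
  have h3 := Complex.reCLM.integral_comp_comm
    (((continuous_poisson hz).smul hcs).integrable_sphere arcMeasure)
  simp only [Complex.reCLM_apply, Pi.smul_apply', Complex.smul_re, smul_eq_mul] at h3
  exact h3

theorem integral_poisson {z : ℂ} (hz : ‖z‖ < 1) :
    ∫ t : Metric.sphere (0 : ℂ) 1, poisson t z ∂arcMeasure = 1 := by
  have := integral_poisson_mul_re (f := fun _ => 1) diffContOnCl_const hz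
  simpa using this

/-- On the circle |t' - t|² = Re(2 - 2 t̄ t'), which is harmonic in t'; evaluate at rt. This second
moment measures how the kernel concentrates at `t`. -/
theorem integral_poisson_mul_norm_sub_sq {r : ℝ} (h0 : 0 ≤ r) (h1 : r < 1)
    (t : Metric.sphere (0 : ℂ) 1) :
    ∫ t' : Metric.sphere (0 : ℂ) 1, poisson t' (r * t) * ‖(t' : ℂ) - t‖ ^ 2 ∂arcMeasure =
      2 - 2 * r := by
  have hd : DiffContOnCl ℂ (fun z : ℂ => 2 - 2 * starRingEnd ℂ (t : ℂ) * z)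
      (Metric.ball 0 1) :=
    Differentiable.diffContOnCl (by fun_prop)
  have key := integral_poisson_mul_re hd (norm_smul_coe_lt_one h0 h1 t)
  have h2 : starRingEnd ℂ (t : ℂ) * t = 1 := by
    rw [mul_comm, Complex.mul_conj, Complex.normSq_eq_norm_sq, norm_coe_sphere_eq_one]
    simp
  have h3 : 2 - 2 * starRingEnd ℂ (t : ℂ) * (r * t) = ((2 - 2 * r : ℝ) : ℂ) := by
    push_cast
    linear_combination (-2 * (r : ℂ)) * h2
  rw [h3, Complex.ofReal_re] at key
  rw [← key]
  refine integral_congr_ae (Eventually.of_forall fun t' => ?_)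
  simp only
  congr 1
  have h4 : Complex.normSq (t : ℂ) = 1 := by
    rw [← Complex.sq_norm, norm_coe_sphere_eq_one, one_pow]
  have h5 : Complex.normSq (t' : ℂ) = 1 := by
    rw [← Complex.sq_norm, norm_coe_sphere_eq_one, one_pow]
  rw [Complex.sq_norm]
  rw [Complex.normSq_apply] at h4 h5 ⊢
  simp only [Complex.sub_re, Complex.sub_im, Complex.mul_re, Complex.mul_im, Complex.conj_re,
    Complex.conj_im, Complex.re_ofNat, Complex.im_ofNat]
  linear_combination h4 + h5

/-- Uniform continuity handles nearby points; at distance at least δ the quadratic term absorbs the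
oscillation 2M. Combined with the second moment, this gives uniform convergence of Poisson integrals
of continuous functions. -/
theorem exists_abs_sub_le_add_mul_norm_sq {f : Metric.sphere (0 : ℂ) 1 → ℝ} (hf : Continuous f)
    {ε : ℝ} (hε : 0 < ε) :
    ∃ C : ℝ, 0 ≤ C ∧ ∀ t t', |f t' - f t| ≤ ε + C * ‖(t' : ℂ) - t‖ ^ 2 := by
  obtain ⟨M, hM⟩ := (isCompact_univ.exists_bound_of_continuousOn hf.continuousOn)
  have hM0 : 0 ≤ M := (norm_nonneg _).trans (hM (cayleyReal 0) (mem_univ _))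
  obtain ⟨δ, hδ, H⟩ := Metric.uniformContinuous_iff.mp
    (CompactSpace.uniformContinuous_of_continuous hf) ε hε
  refine ⟨2 * M / δ ^ 2, by positivity, fun t t' => ?_⟩
  rcases lt_or_ge (dist t' t) δ with h | h
  · have h1 := H h
    rw [Real.dist_eq] at h1
    have : 0 ≤ 2 * M / δ ^ 2 * ‖(t' : ℂ) - t‖ ^ 2 := by positivity
    linarith
  · have h1 : δ ^ 2 ≤ ‖(t' : ℂ) - t‖ ^ 2 := by
      rw [Subtype.dist_eq, dist_eq_norm] at h
      exact pow_le_pow_left₀ hδ.le h 2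
    have h2 : |f t' - f t| ≤ 2 * M := by
      have h3 := hM t (mem_univ _)
      have h4 := hM t' (mem_univ _)
      rw [Real.norm_eq_abs] at h3 h4
      exact (abs_sub _ _).trans (by linarith)
    have h3 : 2 * M ≤ 2 * M / δ ^ 2 * ‖(t' : ℂ) - t‖ ^ 2 := by
      rw [div_mul_eq_mul_div, le_div_iff₀ (by positivity)]
      exact mul_le_mul_of_nonneg_left h1 (by positivity)
    linarith

theorem abs_integral_poisson_mul_sub_le {f : Metric.sphere (0 : ℂ) 1 → ℝ} (hf : Continuous f)
    {ε C : ℝ} (hC : ∀ t t', |f t' - f t| ≤ ε + C * ‖(t' : ℂ) - t‖ ^ 2)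
    {r : ℝ} (h0 : 0 ≤ r) (h1 : r < 1) (t : Metric.sphere (0 : ℂ) 1) :
    |(∫ t', poisson t' (r * t) * f t' ∂arcMeasure) - f t| ≤ ε + C * (2 - 2 * r) := by
  have hz := norm_smul_coe_lt_one h0 h1 t
  have hp := continuous_poisson hz
  have hi : Integrable (fun t' : Metric.sphere (0 : ℂ) 1 => poisson t' (r * t) * f t') arcMeasure :=
    (hp.mul hf).integrable_sphere arcMeasure
  have hi1 := hp.integrable_sphere arcMeasure
  have hi2 : Integrable (fun t' : Metric.sphere (0 : ℂ) 1 =>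
      poisson t' (r * t) * ‖(t' : ℂ) - t‖ ^ 2) arcMeasure :=
    (hp.mul (by fun_prop)).integrable_sphere arcMeasure
  have h2 : (∫ t', poisson t' (r * t) * f t' ∂arcMeasure) - f t =
      ∫ t', poisson t' (r * t) * (f t' - f t) ∂arcMeasure := by
    simp only [mul_sub]
    rw [integral_sub hi (hi1.mul_const _), integral_mul_const, integral_poisson hz, one_mul]
  have h3 : ε + C * (2 - 2 * r) =
      ∫ t' : Metric.sphere (0 : ℂ) 1, (ε * poisson t' (r * t) +
        C * (poisson t' (r * t) * ‖(t' : ℂ) - t‖ ^ 2)) ∂arcMeasure := by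
    rw [integral_add (hi1.const_mul _) (hi2.const_mul _), integral_const_mul, integral_const_mul,
      integral_poisson hz, integral_poisson_mul_norm_sub_sq h0 h1, mul_one]
  rw [h2, h3, ← Real.norm_eq_abs]
  refine norm_integral_le_of_norm_le ((hi1.const_mul _).add (hi2.const_mul _))
    (Eventually.of_forall fun t' => ?_)
  rw [norm_mul, Real.norm_of_nonneg (poisson_nonneg _ hz), Real.norm_eq_abs]
  have := mul_le_mul_of_nonneg_left (hC t t') (poisson_nonneg (t' : ℂ) hz)
  linarith

/-- A finite measure on the circle is the weak limit of the dilations of its Poisson integral. -/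
theorem tendsto_integral_poisson_integral {ν : Measure (Metric.sphere (0 : ℂ) 1)}
    [IsFiniteMeasure ν] {u : ℂ → ℝ}
    (hu : ∀ z : ℂ, ‖z‖ < 1 → ∫ t : Metric.sphere (0 : ℂ) 1, poisson t z ∂ν = u z)
    {f : Metric.sphere (0 : ℂ) 1 → ℝ} (hf : Continuous f) :
    Tendsto (fun r : ℝ => ∫ t : Metric.sphere (0 : ℂ) 1, f t * u (r * t) ∂arcMeasure) (𝓝[<] 1)
      (𝓝 (∫ t, f t ∂ν)) := by
  have hjoint : ∀ r : ℝ, 0 ≤ r → r < 1 → Continuous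
      fun p : Metric.sphere (0 : ℂ) 1 × Metric.sphere (0 : ℂ) 1 =>
        f p.1 * poisson p.2 (r * p.1) := by
    intro r h0 h1
    refine (hf.comp continuous_fst).mul (Continuous.div (by fun_prop) (by fun_prop) fun p => ?_)
    exact pow_ne_zero _ (norm_ne_zero_iff.mpr
      (sphere_sub_ne_zero p.2 (norm_smul_coe_lt_one h0 h1 p.1)))
  have key : ∀ r : ℝ, 0 ≤ r → r < 1 →
      ∫ t : Metric.sphere (0 : ℂ) 1, f t * u (r * t) ∂arcMeasure =
      ∫ t', ∫ t, poisson t (r * t') * f t ∂arcMeasure ∂ν := by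
    intro r h0 h1
    have h2 : ∀ t : Metric.sphere (0 : ℂ) 1,
        f t * u (r * t) = ∫ t', f t * poisson t' (r * t) ∂ν := by
      intro t
      rw [integral_const_mul, hu _ (norm_smul_coe_lt_one h0 h1 t)]
    simp only [h2]
    rw [integral_integral_swap]
    · refine integral_congr_ae (Eventually.of_forall fun t' => ?_)
      refine integral_congr_ae (Eventually.of_forall fun t => ?_)
      simp only
      rw [poisson_symm, mul_comm]
    · exact (hjoint r h0 h1).integrable_of_hasCompactSupport
        (HasCompactSupport.of_compactSpace _)
  rw [Metric.tendsto_nhds]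
  intro ε hε
  set m := ν.real univ with hm
  have hm0 : 0 ≤ m := measureReal_nonneg
  obtain ⟨C, hC0, hC⟩ := exists_abs_sub_le_add_mul_norm_sq hf
    (show 0 < ε / (2 * (m + 1)) by positivity)
  have hlim : Tendsto (fun r : ℝ => (ε / (2 * (m + 1)) + C * (2 - 2 * r)) * m) (𝓝[<] 1)
      (𝓝 (ε / (2 * (m + 1)) * m)) := by
    have h1 : Continuous fun r : ℝ => (ε / (2 * (m + 1)) + C * (2 - 2 * r)) * m := by fun_prop
    have h2 := (h1.tendsto 1).mono_left (nhdsWithin_le_nhds (s := Iio 1))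
    simpa using h2
  have hlt : ε / (2 * (m + 1)) * m < ε := by
    rw [div_mul_eq_mul_div, div_lt_iff₀ (by positivity)]
    nlinarith
  have hIoo : Ioo (0 : ℝ) 1 ∈ 𝓝[<] (1 : ℝ) := Ioo_mem_nhdsLT one_pos
  filter_upwards [hlim.eventually_lt_const hlt, hIoo] with r hr hr01
  rw [dist_eq_norm, key r hr01.1.le hr01.2]
  have hcont : Continuous fun t' : Metric.sphere (0 : ℂ) 1 =>
      ∫ t, poisson t (r * t') * f t ∂arcMeasure := by
    refine continuous_of_dominated (μ := arcMeasure) (F := fun (t' t : Metric.sphere (0 : ℂ) 1) =>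
        poisson t (r * t') * f t)
      (bound := fun _ => (1 - r)⁻¹ ^ 2 * ‖(⟨f, hf⟩ : C(Metric.sphere (0 : ℂ) 1, ℝ))‖)
      (fun t' => ?_) (fun t' => Eventually.of_forall fun t => ?_) (integrable_const _)
      (Eventually.of_forall fun t => ?_)
    · exact ((continuous_poisson (norm_smul_coe_lt_one hr01.1.le hr01.2 t')).mul
        hf).aestronglyMeasurable
    · rw [norm_mul, Real.norm_of_nonneg
        (poisson_nonneg _ (norm_smul_coe_lt_one hr01.1.le hr01.2 t'))]
      refine mul_le_mul ?_ (ContinuousMap.norm_coe_le_norm ⟨f, hf⟩ t) (norm_nonneg _)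
        (by positivity)
      have h4 : 1 - r ≤ ‖(t : ℂ) - r * t'‖ := by
        have := norm_sub_norm_le (t : ℂ) (r * t')
        rwa [norm_mul, norm_coe_sphere_eq_one, norm_coe_sphere_eq_one, mul_one, Complex.norm_real,
          Real.norm_of_nonneg hr01.1.le] at this
      have h5 : 0 < 1 - r := by linarith [hr01.2]
      rw [poisson, inv_pow, ← one_div]
      refine div_le_div₀ zero_le_one (by linarith [sq_nonneg ‖(r : ℂ) * t'‖]) (by positivity) ?_
      exact pow_le_pow_left₀ h5.le h4 2
    · refine Continuous.mul (Continuous.div (by fun_prop) (by fun_prop) fun p => ?_)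
        continuous_const
      exact pow_ne_zero _ (norm_ne_zero_iff.mpr
        (sphere_sub_ne_zero t (norm_smul_coe_lt_one hr01.1.le hr01.2 p)))
  rw [← integral_sub (hcont.integrable_sphere ν) (hf.integrable_sphere ν)]
  refine lt_of_le_of_lt (norm_integral_le_of_norm_le_const
    (C := ε / (2 * (m + 1)) + C * (2 - 2 * r)) (Eventually.of_forall fun t' => ?_)) hr
  rw [Real.norm_eq_abs]
  exact abs_integral_poisson_mul_sub_le hf hC hr01.1.le hr01.2 t'

/-- The integrals of continuous functions are limits determined by the common Poisson integral. -/
theorem eq_of_integral_poisson_eq {ν ν' : Measure (Metric.sphere (0 : ℂ) 1)} [IsFiniteMeasure ν]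
    [IsFiniteMeasure ν'] {u : ℂ → ℝ}
    (hu : ∀ z : ℂ, ‖z‖ < 1 → ∫ t : Metric.sphere (0 : ℂ) 1, poisson t z ∂ν = u z)
    (hu' : ∀ z : ℂ, ‖z‖ < 1 → ∫ t : Metric.sphere (0 : ℂ) 1, poisson t z ∂ν' = u z) : ν = ν' :=
  ext_of_forall_integral_eq_of_IsFiniteMeasure fun f =>
    tendsto_nhds_unique (tendsto_integral_poisson_integral hu f.continuous)
      (tendsto_integral_poisson_integral hu' f.continuous)

/-- **Herglotz's theorem**: an analytic function on the disk with nonnegative real part is given by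
the Poisson integral of a finite measure. -/
theorem exists_integral_poisson_eq_re {h : ℂ → ℂ} (hd : DifferentiableOn ℂ h (Metric.ball 0 1))
    (hpos : ∀ z, ‖z‖ < 1 → 0 ≤ (h z).re) :
    ∃ ν : Measure (Metric.sphere (0 : ℂ) 1), IsFiniteMeasure ν ∧
      ∀ z : ℂ, ‖z‖ < 1 → ∫ t : Metric.sphere (0 : ℂ) 1, poisson t z ∂ν = (h z).re := by
  set r : ℕ → ℝ := fun n => ((n : ℝ) + 1) / (n + 2) with hr
  have hr0 : ∀ n, 0 ≤ r n := fun n => by simp only [hr]; positivity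
  have hr1 : ∀ n, r n < 1 := fun n => by
    simp only [hr]
    rw [div_lt_one (by positivity)]
    linarith
  have hrlim : Tendsto r atTop (𝓝 1) := by
    have h1 : r = fun n : ℕ => 1 - 1 / ((n : ℝ) + 2) := by
      funext n
      simp only [hr]
      have : (n : ℝ) + 2 ≠ 0 := by positivity
      field_simp
      ring
    rw [h1]
    have h2 : Tendsto (fun n : ℕ => 1 / ((n : ℝ) + 2)) atTop (𝓝 0) := by
      simp only [one_div]
      exact tendsto_inv_atTop_zero.comp
        (tendsto_atTop_add_const_right _ _ tendsto_natCast_atTop_atTop)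
    simpa using h2.const_sub 1
  have hball : ∀ n (z : ℂ), ‖z‖ ≤ 1 → (r n : ℂ) * z ∈ Metric.ball (0 : ℂ) 1 := by
    intro n z hz
    rw [mem_ball_zero_iff, norm_mul, Complex.norm_real, Real.norm_of_nonneg (hr0 n)]
    nlinarith [hr1 n, hr0 n, norm_nonneg z]
  have hdil : ∀ n, DiffContOnCl ℂ (fun z => h (r n * z)) (Metric.ball 0 1) := by
    intro n
    refine DifferentiableOn.diffContOnCl ?_
    rw [closure_ball _ one_ne_zero]
    exact hd.comp (by fun_prop) fun z hz => hball n z (by simpa using hz)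
  have hcont : ∀ n, Continuous fun t : Metric.sphere (0 : ℂ) 1 => (h (r n * t)).re := by
    intro n
    refine Complex.continuous_re.comp (hd.continuousOn.comp_continuous (by fun_prop) fun t => ?_)
    exact hball n t (norm_coe_sphere_eq_one t).le
  have hnn : ∀ n (t : Metric.sphere (0 : ℂ) 1), 0 ≤ (h (r n * t)).re := fun n t =>
    hpos _ (norm_smul_coe_lt_one (hr0 n) (hr1 n) t)
  -- Re h on the circle of radius `r n`, as a density. By the mean value property all these measures
  -- have mass Re h(0), so they lie in a compact set.
  set Φ : ℕ → Measure (Metric.sphere (0 : ℂ) 1) := fun n =>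
    arcMeasure.withDensity fun t => ENNReal.ofReal (h (r n * t)).re with hΦ
  have hint : ∀ n (g : Metric.sphere (0 : ℂ) 1 → ℝ),
      ∫ t, g t ∂(Φ n) = ∫ t, g t * (h (r n * t)).re ∂arcMeasure := by
    intro n g
    simp only [hΦ]
    rw [integral_withDensity_eq_integral_toReal_smul (hcont n).measurable.ennreal_ofReal
      (Eventually.of_forall fun _ => ENNReal.ofReal_lt_top)]
    refine integral_congr_ae (Eventually.of_forall fun t => ?_)
    simp only [ENNReal.toReal_ofReal (hnn n t), smul_eq_mul]
    exact mul_comm _ _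
  have hP : ∀ n (z : ℂ), ‖z‖ < 1 → ∫ t : Metric.sphere (0 : ℂ) 1, poisson t z ∂(Φ n) =
      (h (r n * z)).re := by
    intro n z hz
    rw [hint]
    exact integral_poisson_mul_re (hdil n) hz
  have hfin : ∀ n, IsFiniteMeasure (Φ n) := fun n =>
    isFiniteMeasure_withDensity_ofReal ((hcont n).integrable_sphere arcMeasure).2
  have hmass : ∀ n, (Φ n) univ = ENNReal.ofReal (h 0).re := by
    intro n
    have h1 := hP n 0 (by simp)
    have h2 : ∀ t : Metric.sphere (0 : ℂ) 1, poisson t 0 = 1 := fun t => by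
      rw [poisson, sub_zero, norm_coe_sphere_eq_one]
      simp
    simp only [h2, integral_const, smul_eq_mul, mul_one, mul_zero] at h1
    rw [← h1, Measure.real, ENNReal.ofReal_toReal (measure_ne_top _ _)]
  set Ψ : ℕ → FiniteMeasure (Metric.sphere (0 : ℂ) 1) := fun n => ⟨Φ n, hfin n⟩ with hΨ
  have hcpt := isCompact_setOfPred_finiteMeasure_eq_of_compactSpace (Metric.sphere (0 : ℂ) 1)
    (Real.toNNReal (h 0).re)
  -- A limit along a free ultrafilter replaces the extraction of a subsequence.
  obtain ⟨ν, -, hν⟩ := isCompact_iff_ultrafilter_le_nhds.mp hcpt ((hyperfilter ℕ).map Ψ) (by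
    rw [le_principal_iff]
    refine Filter.mem_map.mpr (Eventually.of_forall fun n => ?_)
    change (Ψ n).mass = _
    rw [FiniteMeasure.mass, ← ENNReal.coe_inj, FiniteMeasure.ennreal_coeFn_eq_coeFn_toMeasure]
    exact hmass n)
  have hΨν : Tendsto Ψ (hyperfilter ℕ) (𝓝 ν) := hν
  refine ⟨ν, inferInstance, fun z hz => ?_⟩
  have h1 := FiniteMeasure.tendsto_iff_forall_integral_tendsto.mp hΨν
    (BoundedContinuousFunction.mkOfCompact ⟨_, continuous_poisson hz⟩)
  have h2 : Tendsto (fun n => (h (r n * z)).re) (hyperfilter ℕ) (𝓝 (h z).re) := by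
    refine Tendsto.mono_left ?_ (Nat.hyperfilter_le_atTop)
    have h3 : ContinuousAt h z := hd.continuousOn.continuousAt
      (Metric.isOpen_ball.mem_nhds (by simpa using hz))
    have h4 : Tendsto (fun n => (r n : ℂ) * z) atTop (𝓝 z) := by
      have := ((Complex.continuous_ofReal.tendsto 1).comp hrlim).mul_const z
      simpa using this
    exact (Complex.continuous_re.tendsto _).comp (h3.tendsto.comp h4)
  refine tendsto_nhds_unique h1 (h2.congr fun n => ?_)
  exact (hP n z hz).symm


/-! ### Boundary values and the absolutely continuous part -/

/-- Where the Poisson integral `u` of `ν` extends continuously to the circle, integrals against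
`ν` are given by the boundary values. -/
theorem integral_mul_eq_of_continuousOn {ν : Measure (Metric.sphere (0 : ℂ) 1)}
    [IsFiniteMeasure ν] {U : ℂ → ℝ} {E : Set ℂ}
    (hE : E ⊆ Metric.sphere 0 1) (hU : ContinuousOn U (Metric.closedBall 0 1 \ E))
    (hu : ∀ z : ℂ, ‖z‖ < 1 → ∫ t : Metric.sphere (0 : ℂ) 1, poisson t z ∂ν = U z)
    {f : Metric.sphere (0 : ℂ) 1 → ℝ} (hf : Continuous f) {δ : ℝ} (hδ : 0 < δ)
    (hfδ : ∀ t : Metric.sphere (0 : ℂ) 1, f t ≠ 0 → δ ≤ Metric.infDist (t : ℂ) E) :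
    ∫ t, f t ∂ν = ∫ t : Metric.sphere (0 : ℂ) 1, f t * U t ∂arcMeasure := by
  have hnotmem : ∀ {z : ℂ}, 0 < Metric.infDist z E → z ∉ E := by
    intro z hz hzE
    rw [Metric.infDist_zero_of_mem hzE] at hz
    exact lt_irrefl _ hz
  -- On this compact set `U` is bounded. If f t ≠ 0 and 1 - r < δ/2 then rt stays in it, which gives
  -- domination along the radial limit.
  set K : Set ℂ := Metric.closedBall 0 1 ∩ {z | δ / 2 ≤ Metric.infDist z E} with hK
  have hKc : IsCompact K := (isCompact_closedBall 0 1).inter_right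
    (isClosed_le continuous_const (Metric.continuous_infDist_pt E))
  have hKsub : K ⊆ Metric.closedBall 0 1 \ E := fun z hz => ⟨hz.1, hnotmem (lt_of_lt_of_le
    (by positivity) hz.2)⟩
  obtain ⟨M, hM⟩ := hKc.exists_bound_of_continuousOn (hU.mono hKsub)
  obtain ⟨N, hN⟩ := isCompact_univ.exists_bound_of_continuousOn hf.continuousOn
  have hmem : ∀ (r : ℝ), r ∈ Ioo (max 0 (1 - δ / 2)) 1 → ∀ t : Metric.sphere (0 : ℂ) 1,
      f t ≠ 0 → (r : ℂ) * t ∈ K := by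
    intro r hr t ht
    have hr0 : 0 < r := (le_max_left _ _).trans_lt hr.1
    have hr1 : 1 - δ / 2 < r := (le_max_right _ _).trans_lt hr.1
    refine ⟨?_, ?_⟩
    · simpa using (norm_smul_coe_lt_one hr0.le hr.2 t).le
    · have h1 := Metric.infDist_le_infDist_add_dist (s := E) (x := (t : ℂ)) (y := r * t)
      have h2 : dist (t : ℂ) (r * t) = 1 - r := by
        rw [dist_eq_norm, show (t : ℂ) - r * t = ((1 - r : ℝ) : ℂ) * t by push_cast; ring,
          norm_mul, norm_coe_sphere_eq_one, mul_one, Complex.norm_real,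
          Real.norm_of_nonneg (by linarith [hr.2])]
      have h3 := hfδ t ht
      rw [h2] at h1
      change δ / 2 ≤ _
      linarith
  have hIoo : Ioo (max 0 (1 - δ / 2)) 1 ∈ 𝓝[<] (1 : ℝ) :=
    Ioo_mem_nhdsLT (max_lt one_pos (by linarith))
  refine tendsto_nhds_unique (tendsto_integral_poisson_integral hu hf) ?_
  refine tendsto_integral_filter_of_dominated_convergence (fun _ => N * max M 0) ?_ ?_
    (integrable_const _) ?_
  · filter_upwards [hIoo] with r hr
    have hr0 : 0 < r := (le_max_left _ _).trans_lt hr.1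
    refine (hf.mul (hU.comp_continuous (by fun_prop) fun t => ?_)).aestronglyMeasurable
    have h1 := norm_smul_coe_lt_one hr0.le hr.2 t
    refine ⟨by simpa using h1.le, fun h2 => ?_⟩
    have h3 := hE h2
    rw [mem_sphere_zero_iff_norm] at h3
    exact h1.ne h3
  · filter_upwards [hIoo] with r hr
    refine Eventually.of_forall fun t => ?_
    have hN0 : 0 ≤ N := (norm_nonneg _).trans (hN t (mem_univ _))
    by_cases ht : f t = 0
    · rw [ht, zero_mul, norm_zero]
      positivity
    · rw [norm_mul]
      exact mul_le_mul (hN t (mem_univ _)) ((hM _ (hmem r hr t ht)).trans (le_max_left _ _))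
        (norm_nonneg _) hN0
  · refine Eventually.of_forall fun t => ?_
    by_cases ht : f t = 0
    · simp only [ht, zero_mul]
      exact tendsto_const_nhds
    · refine Tendsto.const_mul _ ?_
      have h1 : (t : ℂ) ∈ Metric.closedBall 0 1 \ E :=
        ⟨Metric.sphere_subset_closedBall t.2, hnotmem (hδ.trans_le (hfδ t ht))⟩
      have h2 : Tendsto (fun r : ℝ => (r : ℂ) * t) (𝓝[<] 1) (𝓝 (t : ℂ)) := by
        have h3 : Continuous fun r : ℝ => (r : ℂ) * t := by fun_prop
        have := (h3.tendsto 1).mono_left (nhdsWithin_le_nhds (s := Iio 1))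
        simpa using this
      refine (hU _ h1).tendsto.comp (tendsto_nhdsWithin_iff.mpr ⟨h2, ?_⟩)
      filter_upwards [hIoo] with r hr
      exact hKsub (hmem r hr t ht)

/-- The complement of `E` is exhausted by the sets at distance at least 1/(n+1) from `E`. On each, a
continuous cutoff equal to 1 there and vanishing near `E` reduces the claim to integrals of
continuous functions. -/
theorem restrict_compl_eq_withDensity {ν : Measure (Metric.sphere (0 : ℂ) 1)}
    [IsFiniteMeasure ν] {U : ℂ → ℝ} {E : Set ℂ} (hEc : IsClosed E) (hne : E.Nonempty)
    (hE : E ⊆ Metric.sphere 0 1) (hU : ContinuousOn U (Metric.closedBall 0 1 \ E))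
    (hUpos : ∀ t ∈ Metric.sphere (0 : ℂ) 1, 0 ≤ U t)
    (hu : ∀ z : ℂ, ‖z‖ < 1 → ∫ t : Metric.sphere (0 : ℂ) 1, poisson t z ∂ν = U z) :
    ν.restrict {t | (t : ℂ) ∉ E} = (arcMeasure.withDensity fun t : Metric.sphere (0 : ℂ) 1 =>
      ENNReal.ofReal (U t)).restrict {t | (t : ℂ) ∉ E} := by
  set A : ℕ → Set (Metric.sphere (0 : ℂ) 1) := fun n =>
    {t | 1 / ((n : ℝ) + 1) ≤ Metric.infDist (t : ℂ) E} with hA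
  have hAm : ∀ n, MeasurableSet (A n) := fun n =>
    measurableSet_le measurable_const
      ((Metric.continuous_infDist_pt E).measurable.comp measurable_subtype_coe)
  have hunion : {t : Metric.sphere (0 : ℂ) 1 | (t : ℂ) ∉ E} = ⋃ n, A n := by
    ext t
    simp only [mem_iUnion, hA]
    constructor
    · intro ht
      have h1 := (hEc.notMem_iff_infDist_pos hne).mp ht
      obtain ⟨n, hn⟩ := exists_nat_one_div_lt h1
      exact ⟨n, hn.le⟩
    · rintro ⟨n, hn⟩
      refine (hEc.notMem_iff_infDist_pos hne).mpr (lt_of_lt_of_le ?_ hn)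
      positivity
  rw [hunion, Measure.restrict_iUnion_congr]
  intro n
  set χ : Metric.sphere (0 : ℂ) 1 → ℝ := fun t =>
    max 0 (min 1 (2 * ((n : ℝ) + 1) * Metric.infDist (t : ℂ) E - 1)) with hχ
  have hχc : Continuous χ := by
    have := (Metric.continuous_infDist_pt E).comp
      (continuous_subtype_val (p := fun z : ℂ => z ∈ Metric.sphere (0 : ℂ) 1))
    exact continuous_const.max (continuous_const.min
      ((continuous_const.mul this).sub continuous_const))
  have hχ0 : ∀ t, 0 ≤ χ t := fun t => le_max_left _ _
  have hχ1 : ∀ t ∈ A n, χ t = 1 := by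
    intro t ht
    have h1 : 1 / ((n : ℝ) + 1) ≤ Metric.infDist (t : ℂ) E := ht
    rw [div_le_iff₀ (by positivity)] at h1
    simp only [hχ]
    rw [min_eq_left (by nlinarith), max_eq_right zero_le_one]
  have hχδ : ∀ t, χ t ≠ 0 → 1 / (2 * ((n : ℝ) + 1)) ≤ Metric.infDist (t : ℂ) E := by
    intro t ht
    by_contra! h
    rw [lt_div_iff₀ (by positivity)] at h
    refine ht (max_eq_left ((min_le_right _ _).trans ?_))
    linarith
  have hint : ∀ f : Metric.sphere (0 : ℂ) 1 → ℝ, Continuous f →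
      ∫ t, f t * χ t ∂ν = ∫ t : Metric.sphere (0 : ℂ) 1, f t * χ t * U t ∂arcMeasure := by
    intro f hf
    refine integral_mul_eq_of_continuousOn hE hU hu (hf.mul hχc)
      (show 0 < 1 / (2 * ((n : ℝ) + 1)) by positivity) (fun t ht => ?_)
    exact hχδ t (right_ne_zero_of_mul ht)
  -- Continuity survives across `E`, where `U` is uncontrolled, because χ vanishes in a
  -- neighbourhood.
  have hχU : Continuous fun t : Metric.sphere (0 : ℂ) 1 => χ t * U t := by
    rw [continuous_iff_continuousAt]
    intro t
    by_cases ht : (t : ℂ) ∈ E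
    · have h1 : ∀ᶠ t' : Metric.sphere (0 : ℂ) 1 in 𝓝 t, χ t' * U t' = 0 := by
        have h2 : Metric.infDist (t : ℂ) E < 1 / (2 * ((n : ℝ) + 1)) := by
          rw [Metric.infDist_zero_of_mem ht]
          positivity
        have h3 := ((Metric.continuous_infDist_pt E).comp
          (continuous_subtype_val (p := fun z : ℂ => z ∈ Metric.sphere (0 : ℂ) 1))).tendsto t
        filter_upwards [h3.eventually_lt_const h2] with t' ht'
        have h4 : χ t' = 0 := by
          by_contra h5
          exact absurd (hχδ t' h5) (not_le.mpr ht')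
        rw [h4, zero_mul]
      exact (continuousAt_const (y := (0 : ℝ))).congr (h1.mono fun _ h => h.symm)
    · refine hχc.continuousAt.mul ?_
      have h1 := hU (t : ℂ) ⟨Metric.sphere_subset_closedBall t.2, ht⟩
      refine h1.tendsto.comp (tendsto_nhdsWithin_iff.mpr
        ⟨continuous_subtype_val.continuousAt, ?_⟩)
      filter_upwards [(hEc.isOpen_compl.preimage continuous_subtype_val).mem_nhds ht] with t' ht'
      exact ⟨Metric.sphere_subset_closedBall t'.2, ht'⟩
  have hχU0 : ∀ t : Metric.sphere (0 : ℂ) 1, 0 ≤ χ t * U t := fun t =>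
    mul_nonneg (hχ0 t) (hUpos t t.2)
  have hmeas : ν.withDensity (fun t => ENNReal.ofReal (χ t)) =
      arcMeasure.withDensity fun t : Metric.sphere (0 : ℂ) 1 => ENNReal.ofReal (χ t * U t) := by
    have : IsFiniteMeasure (ν.withDensity (fun t => ENNReal.ofReal (χ t))) :=
      isFiniteMeasure_withDensity_ofReal (hχc.integrable_sphere ν).2
    have : IsFiniteMeasure (arcMeasure.withDensity fun t : Metric.sphere (0 : ℂ) 1 =>
        ENNReal.ofReal (χ t * U t)) :=
      isFiniteMeasure_withDensity_ofReal (hχU.integrable_sphere arcMeasure).2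
    refine ext_of_forall_integral_eq_of_IsFiniteMeasure fun f => ?_
    rw [integral_withDensity_eq_integral_toReal_smul hχc.measurable.ennreal_ofReal
      (Eventually.of_forall fun _ => ENNReal.ofReal_lt_top),
      integral_withDensity_eq_integral_toReal_smul hχU.measurable.ennreal_ofReal
      (Eventually.of_forall fun _ => ENNReal.ofReal_lt_top)]
    simp only [ENNReal.toReal_ofReal (hχ0 _), ENNReal.toReal_ofReal (hχU0 _), smul_eq_mul]
    have h1 := hint f f.continuous
    rw [show (∫ t, χ t * f t ∂ν) = ∫ t, f t * χ t ∂ν from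
      integral_congr_ae (Eventually.of_forall fun t => mul_comm _ _), h1]
    refine integral_congr_ae (Eventually.of_forall fun t => ?_)
    simp only
    ring
  ext s hs
  rw [Measure.restrict_apply hs, Measure.restrict_apply hs]
  have hsA := hs.inter (hAm n)
  calc ν (s ∩ A n) = ν.withDensity (fun t => ENNReal.ofReal (χ t)) (s ∩ A n) := by
        rw [withDensity_apply _ hsA, setLIntegral_congr_fun (g := fun _ => 1) hsA
          (fun t ht => by rw [hχ1 t ht.2, ENNReal.ofReal_one]), setLIntegral_one]
    _ = arcMeasure.withDensity (fun t : Metric.sphere (0 : ℂ) 1 =>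
          ENNReal.ofReal (χ t * U t)) (s ∩ A n) := by rw [hmeas]
    _ = _ := by
        rw [withDensity_apply _ hsA, withDensity_apply _ hsA]
        exact setLIntegral_congr_fun hsA (fun t ht => by rw [hχ1 t ht.2, one_mul])

/-- The absolutely continuous part of the pullback to the real line of a measure on the circle
whose Poisson integral extends continuously to the circle off a finite set. -/
theorem rnDeriv_comap_cayleyReal {ν : Measure (Metric.sphere (0 : ℂ) 1)}
    [IsFiniteMeasure ν] {U : ℂ → ℝ} {E : Set ℂ} (hEf : E.Finite) (hne : E.Nonempty)
    (hE : E ⊆ Metric.sphere 0 1) (hU : ContinuousOn U (Metric.closedBall 0 1 \ E))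
    (hUm : Measurable U)
    (hUpos : ∀ t ∈ Metric.sphere (0 : ℂ) 1, 0 ≤ U t)
    (hu : ∀ z : ℂ, ‖z‖ < 1 → ∫ t : Metric.sphere (0 : ℂ) 1, poisson t z ∂ν = U z) :
    ∀ᵐ s : ℝ, (ν.comap cayleyReal).rnDeriv volume s =
      ENNReal.ofReal (U (cayleyReal s) * cauchyDensity s) := by
  have hres := restrict_compl_eq_withDensity hEf.isClosed hne hE hU hUpos hu
  set N : Set ℝ := {s | (cayleyReal s : ℂ) ∈ E} with hN
  have hNf : N.Finite := hEf.preimage fun s _ t _ h => cayleyReal_injective (Subtype.ext h)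
  have hN0 : volume N = 0 := hNf.measure_zero _
  have hγm := continuous_cayleyReal.measurable
  have hUγ : Measurable fun s : ℝ => U (cayleyReal s) :=
    hUm.comp (measurable_subtype_coe.comp hγm)
  have hρm : Measurable fun s : ℝ => ENNReal.ofReal (U (cayleyReal s) * cauchyDensity s) :=
    (hUγ.mul measurable_cauchyDensity).ennreal_ofReal
  have hUS : Measurable fun t : Metric.sphere (0 : ℂ) 1 => ENNReal.ofReal (U t) :=
    (hUm.comp measurable_subtype_coe).ennreal_ofReal
  have hcompl : (ν.comap cayleyReal).restrict Nᶜ =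
      volume.withDensity fun s => ENNReal.ofReal (U (cayleyReal s) * cauchyDensity s) := by
    ext s hs
    have hsN : MeasurableSet (s ∩ Nᶜ) := hs.inter hNf.measurableSet.compl
    have himg := measurableEmbedding_cayleyReal.measurableSet_image.mpr hsN
    have hsub : cayleyReal '' (s ∩ Nᶜ) ⊆ {t | (t : ℂ) ∉ E} := by
      rintro _ ⟨x, hx, rfl⟩
      exact hx.2
    rw [Measure.restrict_apply hs, measurableEmbedding_cayleyReal.comap_apply,
      ← Measure.restrict_eq_self ν hsub, hres, Measure.restrict_eq_self _ hsub,
      withDensity_apply _ himg, arcMeasure,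
      setLIntegral_map himg hUS hγm, preimage_image_eq _ cayleyReal_injective,
      setLIntegral_withDensity_eq_setLIntegral_mul _ measurable_cauchyDensity.ennreal_ofReal
        hUγ.ennreal_ofReal hsN, withDensity_apply _ hs]
    have hae : (s ∩ Nᶜ : Set ℝ) =ᵐ[volume] s := by
      refine inter_ae_eq_left_of_ae_eq_univ ?_
      rw [ae_eq_univ, compl_compl]
      exact hN0
    rw [setLIntegral_congr hae]
    refine setLIntegral_congr_fun hs fun x _ => ?_
    simp only [Pi.mul_apply]
    rw [mul_comm, ENNReal.ofReal_mul (hUpos _ (cayleyReal x).2)]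
  -- The part on the finite set `N` is singular, so this is the Lebesgue decomposition.
  have hdecomp : ν.comap cayleyReal = (ν.comap cayleyReal).restrict N +
      volume.withDensity fun s => ENNReal.ofReal (U (cayleyReal s) * cauchyDensity s) := by
    rw [← hcompl, Measure.restrict_add_restrict_compl hNf.measurableSet]
  have hsing : (ν.comap cayleyReal).restrict N ⟂ₘ volume :=
    ⟨Nᶜ, hNf.measurableSet.compl, by
      rw [Measure.restrict_apply hNf.measurableSet.compl, compl_inter_self, measure_empty], by
      rw [compl_compl, hN0]⟩
  filter_upwards [Measure.eq_rnDeriv hρm hsing hdecomp] with s hs using hs.symm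


/-! ### The characteristic function and its Clark measures -/

theorem re_add_div_sub (p q : ℂ) :
    ((p + q) / (p - q)).re = (‖p‖ ^ 2 - ‖q‖ ^ 2) / ‖p - q‖ ^ 2 := by
  have h := congrFun (poissonKernel_eq_re_herglotzRieszKernel (c := 0) (w := q)) p
  simp only [poissonKernel_def, Function.comp_apply, herglotzRieszKernel_def, sub_zero] at h
  exact h.symm

theorem cayleyInv_im (z : ℂ) : (cayleyInv z).im = (1 - ‖z‖ ^ 2) / ‖1 - z‖ ^ 2 := by
  have h := re_add_div_sub 1 z
  rw [norm_one, one_pow] at h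
  rw [cayleyInv, mul_div_assoc, Complex.I_mul_im, h]

theorem one_sub_ne_zero_of_norm_lt {z : ℂ} (hz : ‖z‖ < 1) : 1 - z ≠ 0 := by
  intro h
  rw [← sub_eq_zero.mp h, norm_one] at hz
  exact lt_irrefl _ hz

theorem cayleyInv_im_pos {z : ℂ} (hz : ‖z‖ < 1) : 0 < (cayleyInv z).im := by
  rw [cayleyInv_im]
  have h1 : 0 < ‖1 - z‖ := norm_pos_iff.mpr (one_sub_ne_zero_of_norm_lt hz)
  have h2 : ‖z‖ ^ 2 < 1 := pow_lt_one₀ (norm_nonneg z) hz two_ne_zero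
  exact div_pos (by linarith) (by positivity)

theorem cayleyInv_im_nonneg {z : ℂ} (hz : ‖z‖ ≤ 1) : 0 ≤ (cayleyInv z).im := by
  rw [cayleyInv_im]
  have h2 : ‖z‖ ^ 2 ≤ 1 := pow_le_one₀ (norm_nonneg z) hz
  exact div_nonneg (by linarith) (by positivity)

theorem cayley_cayleyInv {z : ℂ} (hz : z ≠ 1) :
    (cayleyInv z - Complex.I) / (cayleyInv z + Complex.I) = z := by
  have h1 : 1 - z ≠ 0 := sub_ne_zero.mpr hz.symm
  have h2 : cayleyInv z - Complex.I = 2 * Complex.I * z / (1 - z) := by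
    rw [cayleyInv]
    field_simp
    ring
  have h3 : cayleyInv z + Complex.I = 2 * Complex.I / (1 - z) := by
    rw [cayleyInv]
    field_simp
    ring
  have h4 := Complex.I_ne_zero
  rw [h2, h3]
  field_simp

theorem ofReal_norm_sq_eq_one {α : ℂ} (hα : ‖α‖ = 1) : α.re ^ 2 + α.im ^ 2 = 1 := by
  have h := Complex.sq_norm α
  rw [hα, Complex.normSq_apply] at h
  linarith

namespace HalfLine

/-- ρ and -ρ̄ are mirror images in the imaginary axis, so only Re ζ survives. This yields both |B| <
1 and the numerator of the density. -/
theorem norm_add_sq_sub_norm_sub_sq (ζ : ℂ) :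
    ‖ζ + starRingEnd ℂ root8‖ ^ 2 - ‖ζ - root8‖ ^ 2 = 2 * Real.sqrt 2 * ζ.re := by
  have h : (Real.sqrt 2)⁻¹ * 2 = Real.sqrt 2 := by
    have h1 := (Real.sqrt_pos.mpr (zero_lt_two (α := ℝ))).ne'
    field_simp
    exact (Real.sq_sqrt zero_le_two).symm
  rw [Complex.sq_norm, Complex.sq_norm, Complex.normSq_apply, Complex.normSq_apply]
  simp only [Complex.add_re, Complex.sub_re, Complex.add_im, Complex.sub_im, Complex.conj_re,
    Complex.conj_im, root8_re, root8_im]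
  linear_combination 2 * ζ.re * h

theorem norm_sub_lt_norm_add {ζ : ℂ} (h : 0 < ζ.re) :
    ‖ζ - root8‖ < ‖ζ + starRingEnd ℂ root8‖ := by
  have h1 := norm_add_sq_sub_norm_sub_sq ζ
  have h2 : 0 < 2 * Real.sqrt 2 * ζ.re := by positivity
  exact lt_of_pow_lt_pow_left₀ 2 (norm_nonneg _) (by linarith)

theorem livsic_formula {w : ℂ} (hw : 0 < w.im) :
    livsic psi phiPlus phiMinus w =
      ((w - Complex.I) * (csqrt w - starRingEnd ℂ root8)) /
        ((w + Complex.I) * (csqrt w + root8)) := by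
  have hq : (((2 : ℝ) ^ (1 / 4 : ℝ) : ℝ) : ℂ) ≠ 0 := by
    exact_mod_cast (Real.rpow_pos_of_pos zero_lt_two _).ne'
  have hψ := psi_exponent_re hw
  rw [livsic, phiPlus_eq, phiMinus_eq, psi, inner_smul_left, inner_smul_left,
    inner_expVec neg_conj_root8_re hψ, inner_expVec neg_root8_re hψ, Complex.conj_ofReal, map_neg,
    map_neg, Complex.conj_conj]
  have h1 : Complex.I * csqrt w + -root8 = Complex.I * (csqrt w - starRingEnd ℂ root8) := by
    linear_combination I_mul_conj_root8
  have h2 : Complex.I * csqrt w + -starRingEnd ℂ root8 = Complex.I * (csqrt w + root8) := by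
    linear_combination -I_mul_root8
  rw [h1, h2, mul_inv, inv_neg, inv_inv]
  have h3 := Complex.I_ne_zero
  rw [mul_inv]
  field_simp

/-- w - i = (√w - ρ)(√w + ρ) and w + i = (√w - ρ̄)(√w + ρ̄). The common factors do not vanish: √w
has positive real and imaginary parts, while -ρ has negative real part and ρ̄ negative imaginary
part. -/
theorem livsic_eq {w : ℂ} (hw : 0 < w.im) :
    livsic psi phiPlus phiMinus w =
      (csqrt w - root8) / (csqrt w + starRingEnd ℂ root8) := by
  have hre := csqrt_re_pos hw
  have him := csqrt_im_pos hw
  have hc := inv_sqrt_two_pos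
  have hne1 : csqrt w + root8 ≠ 0 := fun h => by
    have := congrArg Complex.re h
    rw [Complex.add_re, root8_re, Complex.zero_re] at this
    linarith
  have hne2 : csqrt w + starRingEnd ℂ root8 ≠ 0 := fun h => by
    have := congrArg Complex.re h
    rw [Complex.add_re, Complex.conj_re, root8_re, Complex.zero_re] at this
    linarith
  have hne3 : csqrt w - starRingEnd ℂ root8 ≠ 0 := fun h => by
    have := congrArg Complex.im h
    rw [Complex.sub_im, Complex.conj_im, root8_im, Complex.zero_im] at this
    linarith
  have h1 : w - Complex.I = (csqrt w - root8) * (csqrt w + root8) := by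
    linear_combination -csqrt_sq w + root8_sq
  have h2 : w + Complex.I =
      (csqrt w - starRingEnd ℂ root8) * (csqrt w + starRingEnd ℂ root8) := by
    linear_combination -csqrt_sq w + conj_root8_sq
  rw [livsic_formula hw, h1, h2]
  field_simp

theorem csqrt_add_conj_root8_ne_zero (w : ℂ) : csqrt w + starRingEnd ℂ root8 ≠ 0 := fun h => by
  have := congrArg Complex.re h
  rw [Complex.add_re, Complex.conj_re, root8_re, Complex.zero_re] at this
  linarith [csqrt_re_nonneg w, inv_sqrt_two_pos]

theorem norm_livsic_lt_one {w : ℂ} (hw : 0 < w.im) : ‖livsic psi phiPlus phiMinus w‖ < 1 := by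
  rw [livsic_eq hw, norm_div, div_lt_one (norm_pos_iff.mpr (csqrt_add_conj_root8_ne_zero w))]
  exact norm_sub_lt_norm_add (csqrt_re_pos hw)

theorem differentiableAt_csqrt {w : ℂ} (hw : 0 < w.im) : DifferentiableAt ℂ csqrt w :=
  differentiableAt_id.cpow (differentiableAt_const _) (Or.inr hw.ne')

theorem isSchurUpper_livsic : IsSchurUpper (livsic psi phiPlus phiMinus) := by
  refine ⟨?_, fun w hw => (norm_livsic_lt_one hw).le⟩
  have h : DifferentiableOn ℂ (fun w => (csqrt w - root8) / (csqrt w + starRingEnd ℂ root8))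
      {w | 0 < w.im} := fun w hw =>
    (((differentiableAt_csqrt hw).sub_const _).div ((differentiableAt_csqrt hw).add_const _)
      (csqrt_add_conj_root8_ne_zero w)).differentiableWithinAt
  exact h.congr fun w hw => livsic_eq hw

/-- The real part of `(α + b)/(α - b)`, extended to the boundary of the disk. -/
def clarkRe (α z : ℂ) : ℝ :=
  ((α * (csqrt (cayleyInv z) + starRingEnd ℂ root8) + (csqrt (cayleyInv z) - root8)) /
    (α * (csqrt (cayleyInv z) + starRingEnd ℂ root8) - (csqrt (cayleyInv z) - root8))).re

theorem clarkRe_eq {α : ℂ} (hα : ‖α‖ = 1) (z : ℂ) :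
    clarkRe α z = 2 * Real.sqrt 2 * (csqrt (cayleyInv z)).re /
      ‖α * (csqrt (cayleyInv z) + starRingEnd ℂ root8) - (csqrt (cayleyInv z) - root8)‖ ^ 2 := by
  rw [clarkRe, re_add_div_sub, norm_mul, hα, one_mul, norm_add_sq_sub_norm_sub_sq]

theorem clarkRe_nonneg {α : ℂ} (hα : ‖α‖ = 1) (z : ℂ) : 0 ≤ clarkRe α z := by
  rw [clarkRe_eq hα]
  have := csqrt_re_nonneg (cayleyInv z)
  positivity

theorem measurable_clarkRe (α : ℂ) : Measurable (clarkRe α) := by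
  unfold clarkRe cayleyInv csqrt
  fun_prop

theorem re_div_livsic_eq_clarkRe (α : ℂ) {z : ℂ} (hz : ‖z‖ < 1) :
    ((α + livsic psi phiPlus phiMinus (cayleyInv z)) /
      (α - livsic psi phiPlus phiMinus (cayleyInv z))).re = clarkRe α z := by
  have h := csqrt_add_conj_root8_ne_zero (cayleyInv z)
  rw [livsic_eq (cayleyInv_im_pos hz), clarkRe, add_div' _ _ _ h, sub_div' h,
    div_div_div_cancel_right₀ h]

theorem sub_livsic_ne_zero {α : ℂ} (hα : ‖α‖ = 1) {w : ℂ} (hw : 0 < w.im) :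
    α - livsic psi phiPlus phiMinus w ≠ 0 := by
  intro h
  have h1 := norm_livsic_lt_one hw
  rw [← sub_eq_zero.mp h, hα] at h1
  exact lt_irrefl _ h1

theorem exists_isCircleClarkMeasure {α : ℂ} (hα : ‖α‖ = 1) :
    ∃ ν, IsCircleClarkMeasure (fun z => livsic psi phiPlus phiMinus (cayleyInv z)) α ν := by
  have hd : DifferentiableOn ℂ (fun z => livsic psi phiPlus phiMinus (cayleyInv z))
      (Metric.ball 0 1) := by
    refine isSchurUpper_livsic.1.comp (fun z hz => ?_) fun z hz =>
      cayleyInv_im_pos (by simpa using hz)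
    have h1 : 1 - z ≠ 0 := one_sub_ne_zero_of_norm_lt (by simpa using hz)
    unfold cayleyInv
    exact (DifferentiableAt.div (by fun_prop) (by fun_prop) h1).differentiableWithinAt
  obtain ⟨ν, hν, h⟩ := exists_integral_poisson_eq_re
    (h := fun z => (α + livsic psi phiPlus phiMinus (cayleyInv z)) /
      (α - livsic psi phiPlus phiMinus (cayleyInv z)))
    ((hd.const_add α).div (hd.const_sub α) fun z hz =>
      sub_livsic_ne_zero hα (cayleyInv_im_pos (by simpa using hz)))
    (fun z hz => by
      rw [re_div_livsic_eq_clarkRe α hz]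
      exact clarkRe_nonneg hα z)
  exact ⟨ν, hν, h⟩

theorem isCircleClarkMeasure_unique {b : ℂ → ℂ} {α : ℂ}
    {ν ν' : Measure (Metric.sphere (0 : ℂ) 1)} (h : IsCircleClarkMeasure b α ν)
    (h' : IsCircleClarkMeasure b α ν') : ν = ν' := by
  have := h.1
  have := h'.1
  exact eq_of_integral_poisson_eq h.2 h'.2

/-- The branch cut is harmless from above: on the negative axis the principal logarithm is
continuous within the closed upper half-plane. -/
theorem continuousWithinAt_csqrt {w : ℂ} (h0 : w ≠ 0) :
    ContinuousWithinAt csqrt {w | 0 ≤ w.im} w := by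
  have hlog : ContinuousWithinAt Complex.log {w | 0 ≤ w.im} w := by
    by_cases hs : w ∈ Complex.slitPlane
    · exact (continuousAt_clog hs).continuousWithinAt
    · rw [Complex.mem_slitPlane_iff, not_or, not_lt, not_not] at hs
      refine Complex.continuousWithinAt_log_of_re_neg_of_im_zero (lt_of_le_of_ne hs.1 fun h => ?_)
        hs.2
      exact h0 (Complex.ext h hs.2)
  have h1 : ContinuousWithinAt (fun w => Complex.exp (Complex.log w * (1 / 2))) {w | 0 ≤ w.im} w :=
    (hlog.mul continuousWithinAt_const).cexp
  refine h1.congr_of_eventuallyEq ?_ (by rw [csqrt, Complex.cpow_def_of_ne_zero h0])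
  filter_upwards [mem_nhdsWithin_of_mem_nhds (isOpen_ne.mem_nhds h0)] with v hv
  rw [csqrt, Complex.cpow_def_of_ne_zero hv]

/-- The points of the circle where `(α + b)/(α - b)` may fail to extend continuously. -/
def clarkExceptional (α : ℂ) : Set ℂ :=
  {1, -1} ∪ ({((((α * starRingEnd ℂ root8 + root8) / (1 - α)) ^ 2 - Complex.I) /
    (((α * starRingEnd ℂ root8 + root8) / (1 - α)) ^ 2 + Complex.I))} ∩ Metric.sphere 0 1)

theorem clarkExceptional_finite (α : ℂ) : (clarkExceptional α).Finite :=
  (Set.toFinite _).union ((Set.finite_singleton _).inter_of_left _)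

theorem clarkExceptional_subset (α : ℂ) : clarkExceptional α ⊆ Metric.sphere 0 1 := by
  rintro z ((rfl | rfl) | h)
  · simp
  · simp
  · exact h.2

/-- Inside the disk |√w - ρ| < |√w + ρ̄| forbids a zero. On the circle a zero forces √w = (αρ̄ +
ρ)/(1 - α), whose square is the point that `clarkExceptional` transports to the circle; 1 and -1
there correspond to ∞ and 0. -/
theorem clarkRe_denominator_ne_zero {α : ℂ} (hα : ‖α‖ = 1) {z : ℂ}
    (hz : z ∈ Metric.closedBall (0 : ℂ) 1 \ clarkExceptional α) :
    α * (csqrt (cayleyInv z) + starRingEnd ℂ root8) - (csqrt (cayleyInv z) - root8) ≠ 0 := by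
  intro h
  have hz1 : z ≠ 1 := fun h1 => hz.2 (Or.inl (Or.inl h1))
  have hle : ‖z‖ ≤ 1 := by simpa using hz.1
  rcases hle.lt_or_eq with hlt | heq
  · have h1 := norm_sub_lt_norm_add (csqrt_re_pos (cayleyInv_im_pos hlt))
    rw [← sub_eq_zero.mp h, norm_mul, hα, one_mul] at h1
    exact lt_irrefl _ h1
  · have h2 : (1 - α) * csqrt (cayleyInv z) = α * starRingEnd ℂ root8 + root8 := by
      linear_combination -h
    -- For α = 1 the equation reads 0 = ρ + ρ̄ = √2, so there is no zero.
    by_cases hα1 : 1 - α = 0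
    · rw [hα1, zero_mul, ← sub_eq_zero.mp hα1, one_mul, add_comm, root8_add_conj] at h2
      exact sqrt_two_ne_zero h2.symm
    · refine hz.2 (Or.inr ⟨?_, by simpa using heq⟩)
      rw [mem_singleton_iff, ← h2, mul_div_cancel_left₀ _ hα1, csqrt_sq, cayley_cayleyInv hz1]

theorem continuousOn_clarkRe {α : ℂ} (hα : ‖α‖ = 1) :
    ContinuousOn (clarkRe α) (Metric.closedBall 0 1 \ clarkExceptional α) := by
  intro z hz
  have hz1 : z ≠ 1 := fun h1 => hz.2 (Or.inl (Or.inl h1))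
  have hz2 : z ≠ -1 := fun h1 => hz.2 (Or.inl (Or.inr h1))
  have h1 : 1 - z ≠ 0 := sub_ne_zero.mpr hz1.symm
  have hw0 : cayleyInv z ≠ 0 := by
    rw [cayleyInv]
    refine div_ne_zero (mul_ne_zero Complex.I_ne_zero fun h => hz2 ?_) h1
    linear_combination h
  have hcay : ContinuousWithinAt cayleyInv (Metric.closedBall 0 1 \ clarkExceptional α) z := by
    unfold cayleyInv
    exact (ContinuousAt.div (by fun_prop) (by fun_prop) h1).continuousWithinAt
  have hsq : ContinuousWithinAt (fun z => csqrt (cayleyInv z))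
      (Metric.closedBall 0 1 \ clarkExceptional α) z :=
    (continuousWithinAt_csqrt hw0).comp hcay
      fun v hv => cayleyInv_im_nonneg (by simpa using hv.1)
  have hnum := (hsq.add_const (starRingEnd ℂ root8)).const_mul α
  have hsub := hsq.sub_const root8
  exact Complex.continuous_re.continuousAt.comp_continuousWithinAt
    ((hnum.add hsub).div (hnum.sub hsub) (clarkRe_denominator_ne_zero hα hz))

/-! ### The explicit density -/

theorem csqrt_re_of_nonpos {s : ℝ} (hs : s ≤ 0) : (csqrt (s : ℂ)).re = 0 := by
  have h1 := congrArg Complex.re (csqrt_sq (s : ℂ))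
  have h2 := re_mul_im_csqrt (s : ℂ)
  rw [Complex.ofReal_im] at h2
  rw [sq, Complex.mul_re, Complex.ofReal_re] at h1
  by_contra h
  have h3 : (csqrt (s : ℂ)).im = 0 := by
    rcases mul_eq_zero.mp (mul_eq_zero.mp h2 |>.resolve_left two_ne_zero) with h4 | h4
    · exact absurd h4 h
    · exact h4
  rw [h3] at h1
  have h4 : 0 < (csqrt (s : ℂ)).re * (csqrt (s : ℂ)).re := mul_self_pos.mpr h
  linarith

theorem csqrt_of_pos {s : ℝ} (hs : 0 < s) : csqrt (s : ℂ) = (Real.sqrt s : ℝ) := by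
  refine csqrt_eq_of_sq_eq ?_ (by rw [Complex.ofReal_re]; exact Real.sqrt_pos.mpr hs)
  rw [← Complex.ofReal_pow, Real.sq_sqrt hs.le]

theorem exp_neg_I_mul_pi_div_four :
    Complex.exp (-(Complex.I * Real.pi / 4)) = starRingEnd ℂ root8 := by
  have h : -(Complex.I * Real.pi / 4) = ((-(Real.pi / 4) : ℝ) : ℂ) * Complex.I := by
    push_cast
    ring
  have h2 : Real.sqrt 2 / 2 = (Real.sqrt 2)⁻¹ := by
    have h1 := (Real.sqrt_pos.mpr (zero_lt_two (α := ℝ))).ne'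
    field_simp
    exact Real.sq_sqrt zero_le_two
  apply Complex.ext
  · rw [h, Complex.exp_ofReal_mul_I_re, Real.cos_neg, Real.cos_pi_div_four, Complex.conj_re,
      root8_re, h2]
  · rw [h, Complex.exp_ofReal_mul_I_im, Real.sin_neg, Real.sin_pi_div_four, Complex.conj_im,
      root8_im, h2]

theorem norm_sq_denominator {α : ℂ} (hα : ‖α‖ = 1) (x : ℝ) :
    ‖α * ((x : ℂ) + starRingEnd ℂ root8) - ((x : ℂ) - root8)‖ ^ 2 =
      2 * (1 - α.re) * x ^ 2 + 2 * (1 + α.im) := by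
  have h1 := ofReal_norm_sq_eq_one hα
  have h2 : (Real.sqrt 2)⁻¹ ^ 2 = 1 / 2 := by
    rw [inv_pow, Real.sq_sqrt zero_le_two, one_div]
  rw [Complex.sq_norm, Complex.normSq_apply]
  simp only [Complex.add_re, Complex.sub_re, Complex.add_im, Complex.sub_im, Complex.conj_re,
    Complex.conj_im, root8_re, root8_im, Complex.mul_re, Complex.mul_im, Complex.ofReal_re,
    Complex.ofReal_im]
  generalize (Real.sqrt 2)⁻¹ = c at *
  linear_combination (x ^ 2 + 2 * c * x + 2 * c ^ 2) * h1 + (4 + 4 * α.im) * h2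

/-- The polynomial in √s factors, using |iα - 1|² = 2(1 + Im α). The second factor is the squared
denominator of `clarkRe` at √s, by `norm_sq_denominator`. -/
theorem denomD_of_pos {α : ℂ} (hα : ‖α‖ = 1) {s : ℝ} (hs : 0 < s) :
    denomD α s = (((s - Real.sqrt 2 * Real.sqrt s + 1) *
      (2 * (1 - α.re) * s + 2 * (1 + α.im)) : ℝ) : ℂ) := by
  have h1 := ofReal_norm_sq_eq_one hα
  have h2 : ‖Complex.I * α - 1‖ ^ 2 = 2 + 2 * α.im := by
    rw [Complex.sq_norm, Complex.normSq_apply]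
    simp only [Complex.sub_re, Complex.sub_im, Complex.I_mul_re, Complex.I_mul_im, Complex.one_re,
      Complex.one_im]
    linear_combination h1
  have h3 : (2 : ℝ) ^ (3 / 2 : ℝ) = 2 * Real.sqrt 2 := by
    rw [show (3 / 2 : ℝ) = 1 + 1 / 2 by norm_num, Real.rpow_add zero_lt_two, Real.rpow_one,
      Real.sqrt_eq_rpow]
  have h4 : (s : ℂ) ^ (1 / 2 : ℂ) = (Real.sqrt s : ℝ) := csqrt_of_pos hs
  have h5 : (s : ℂ) ^ (3 / 2 : ℂ) = ((s * Real.sqrt s : ℝ) : ℂ) := by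
    rw [show (3 / 2 : ℂ) = 1 + 1 / 2 by norm_num,
      Complex.cpow_add _ _ (by exact_mod_cast hs.ne'), Complex.cpow_one, h4, Complex.ofReal_mul]
  rw [denomD, h2, h3, h4, h5, abs_of_pos hs]
  push_cast
  ring

/-- For s ≤ 0 both numerators vanish, whatever the denominators are. For s > 0 the first factor of
`denomD` combines with s + 1 + √(2s) to give the 1 + s² of the Cauchy density. -/
theorem clarkRe_mul_cauchyDensity {α : ℂ} (hα : ‖α‖ = 1) (s : ℝ) :
    ((clarkRe α (cayleyReal s) * cauchyDensity s : ℝ) : ℂ) = weight α s := by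
  rw [clarkRe_eq hα, cayleyInv_cayleyReal, weight]
  rcases le_or_gt s 0 with hs | hs
  · have h2 : (csqrt (2 * (s : ℂ))).re = 0 := by
      have := csqrt_re_of_nonpos (show 2 * s ≤ 0 by linarith)
      rwa [Complex.ofReal_mul, Complex.ofReal_ofNat] at this
    rw [csqrt_re_of_nonpos hs, h2]
    simp
  · have h2 : csqrt (2 * (s : ℂ)) = (Real.sqrt 2 * Real.sqrt s : ℝ) := by
      rw [← Real.sqrt_mul zero_le_two, ← csqrt_of_pos (by positivity)]
      push_cast
      rfl
    have h3 : ((Real.sqrt s : ℂ) * starRingEnd ℂ root8).re = Real.sqrt s * (Real.sqrt 2)⁻¹ := by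
      rw [Complex.re_ofReal_mul, Complex.conj_re, root8_re]
    rw [h2, csqrt_of_pos hs, exp_neg_I_mul_pi_div_four, h3, norm_sq_denominator hα,
      denomD_of_pos hα hs, Real.sq_sqrt hs.le, ← Complex.ofReal_mul, ← Complex.ofReal_div,
      abs_of_pos hs, Complex.ofReal_re, Complex.ofReal_re, cauchyDensity, div_mul_div_comm]
    congr 2
    · ring
    · have h4 : (Real.sqrt 2)⁻¹ * 2 = Real.sqrt 2 := by
        have h1 := (Real.sqrt_pos.mpr (zero_lt_two (α := ℝ))).ne'
        field_simp
        exact (Real.sq_sqrt zero_le_two).symm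
      have h5 : Real.sqrt 2 ^ 2 = 2 := Real.sq_sqrt zero_le_two
      have h6 : Real.sqrt s ^ 2 = s := Real.sq_sqrt hs.le
      have h7 : (s + 1 + 2 * (Real.sqrt s * (Real.sqrt 2)⁻¹)) *
          (s - Real.sqrt 2 * Real.sqrt s + 1) = 1 + s ^ 2 := by
        rw [show 2 * (Real.sqrt s * (Real.sqrt 2)⁻¹) = Real.sqrt 2 * Real.sqrt s by
          linear_combination Real.sqrt s * h4]
        linear_combination (-(Real.sqrt 2) ^ 2) * h6 - s * h5
      rw [← h7]
      ring

theorem rnDeriv_isClarkMeasure {α : ℂ} (hα : ‖α‖ = 1) {μ : Measure ℝ}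
    (hμ : IsClarkMeasure (livsic psi phiPlus phiMinus) α μ) :
    ∀ᵐ s : ℝ, μ.rnDeriv volume s =
      ENNReal.ofReal (clarkRe α (cayleyReal s) * cauchyDensity s) := by
  obtain ⟨ν, ⟨hfin, hν⟩, rfl⟩ := hμ
  refine rnDeriv_comap_cayleyReal (clarkExceptional_finite α) ⟨1, Or.inl (Or.inl rfl)⟩
    (clarkExceptional_subset α) (continuousOn_clarkRe hα) (measurable_clarkRe α)
    (fun t _ => clarkRe_nonneg hα t) fun z hz => ?_
  rw [← re_div_livsic_eq_clarkRe α hz]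
  exact hν z hz

end HalfLine

end

/-! ### The main theorem -/

theorem mainTheorem7 :
    IsDefectBasis HalfLine.kMin HalfLine.psi HalfLine.phiPlus HalfLine.phiMinus ∧
    (∀ w : ℂ, 0 < w.im →
      livsic HalfLine.psi HalfLine.phiPlus HalfLine.phiMinus w =
        ((w - Complex.I) * (HalfLine.csqrt w - (1 - Complex.I) / (Real.sqrt 2 : ℂ))) /
          ((w + Complex.I) * (HalfLine.csqrt w + (1 + Complex.I) / (Real.sqrt 2 : ℂ)))) ∧
    IsSchurUpper (livsic HalfLine.psi HalfLine.phiPlus HalfLine.phiMinus) ∧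
    ∀ α : ℂ, ‖α‖ = 1 →
      HalfLine.kMin ≤ HalfLine.kExt α ∧ IsSelfAdjoint (HalfLine.kExt α) ∧
      (∃! μ : Measure ℝ,
        IsClarkMeasure (livsic HalfLine.psi HalfLine.phiPlus HalfLine.phiMinus) α μ) ∧
      ∀ μ : Measure ℝ,
        IsClarkMeasure (livsic HalfLine.psi HalfLine.phiPlus HalfLine.phiMinus) α μ →
        (∀ᵐ s : ℝ, ((μ.rnDeriv volume s).toReal : ℂ) = HalfLine.weight α s) ∧
        (∀ᵐ s : ℝ, s ≤ 0 → μ.rnDeriv volume s = 0) := by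
  refine ⟨HalfLine.isDefectBasis_kMin, fun w hw => ?_, HalfLine.isSchurUpper_livsic,
    fun α hα => ⟨HalfLine.kMin_le_kExt α, HalfLine.isSelfAdjoint_kExt hα, ?_, fun μ hμ => ?_⟩⟩
  · rw [HalfLine.livsic_formula hw, HalfLine.conj_root8, HalfLine.root8]
  · obtain ⟨ν, hν⟩ := HalfLine.exists_isCircleClarkMeasure hα
    refine ⟨_, ⟨ν, hν, rfl⟩, ?_⟩
    rintro μ ⟨ν', hν', rfl⟩
    rw [HalfLine.isCircleClarkMeasure_unique hν' hν]
  · have h := HalfLine.rnDeriv_isClarkMeasure hα hμ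
    constructor
    · filter_upwards [h] with s hs
      rw [hs, ENNReal.toReal_ofReal (mul_nonneg (HalfLine.clarkRe_nonneg hα _)
        (cauchyDensity_nonneg s)), HalfLine.clarkRe_mul_cauchyDensity hα]
    · filter_upwards [h] with s hs hs0
      rw [hs, HalfLine.clarkRe_eq hα, cayleyInv_cayleyReal, HalfLine.csqrt_re_of_nonpos hs0]
      simp
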